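/- Let $S=\mathrm{Spec}(A)$ be an affine scheme and let $\mathcal G=\mathrm{Spec}(B)$, with projections $p_1,p_2:\mathcal G\to S$, unit $1_{\mathcal G}:S\to\mathcal G$, multiplication $\mathrm{mult}:\mathcal G\times_{p_2,S,p_1}\mathcal G\to\mathcal G$ and inversion, be an affine groupoid over $S$ with $p_1,p_2$ flat. Let $\mathcal C'$ be an $A$-linear abelian category with small filtered colimits, which are exact. For a ring homomorphism $A\to R$, $S'=\mathrm{Spec}(R)$, let $\mathcal C'\times_S S'$ be the category of objects of $\mathcal C'$ endowed with an action of $R$ whose restriction to $A$ is the given action; for $f:S''=\mathrm{Spec}(R')\to S'$ over $S$, let $f_*:\mathcal C'\times_S S''\to\mathcal C'\times_S S'$ be the restriction of the action and $f^*=R'\otimes_R-$ its left adjoint. Let $\mathcal G$ act on $\mathcal C'$. That is, we are given a functor $\mathrm{act}^*:\mathcal C'\to\mathcal C'\times_{S,p_1}\mathcal G$, which is $A$-linear when the target is regarded as a category over $S$ via $p_2$, together with a unit constraint $1_{\mathcal G}^*\,\mathrm{act}^*\simeq\mathrm{id}$ and an associativity constraint $\mathrm{mult}^*\,\mathrm{act}^*\simeq(\mathrm{act}^*\times\mathrm{id}_{\mathcal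 G})\,\mathrm{act}^*$ (isomorphisms of functors), such that the two isomorphisms over $\mathcal G\times_S\mathcal G\times_S\mathcal G$ between the pullback of $\mathrm{act}^*$ along the triple multiplication and the threefold iterate of $\mathrm{act}^*$ coincide, and the two automorphisms of $\mathrm{act}^*$ obtained from the two constraints by restriction along $g\mapsto(1,g)$ and $g\mapsto(g,1)$ are the identity. A $\mathcal G$-equivariant structure on $X\in\mathcal C'$ is an isomorphism $\alpha:p_1^*(X)\simeq\mathrm{act}^*(X)$ in $\mathcal C'\times_{S,p_1}\mathcal G$ compatible with the unit and associativity constraints; let $\mathcal C'^{\mathcal G}$ be the category of objects of $\mathcal C'$ with a $\mathcal G$-equivariant structure, with morphisms those of $\mathcal C'$ compatible with the $\alpha$'s. (a) For every $X\in\mathcal C'$ the object $(p_1)_*(\mathrm{act}^*(X))$ is naturally $\mathcal G$-equivariant: the morphism $p_1^*\big((p_1)_*\mathrm{act}^*(X)\big)\to\mathrm{act}^*\big((p_1)_*\mathrm{act}^*(X)\big)$ that corresponds, by the adjunctions between pullback and direct image, to the associativity constraint is an isomorphism and a $\mathcal G$-equivariant structure, and for every morphism $u:X\to Y$ of $\mathcal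 C'$ the morphism $(p_1)_*(\mathrm{act}^*(u))$ is $\mathcal G$-equivariant. (b) The resulting functor $\mathcal C'\to\mathcal C'^{\mathcal G}$, $X\mapsto(p_1)_*(\mathrm{act}^*(X))$, is right adjoint to the forgetful functor $\mathcal C'^{\mathcal G}\to\mathcal C'$. -/

import Mathlib

open CategoryTheory CategoryTheory.Limits

universe w v u

noncomputable section

namespace GroupoidAction

/-! ### Fibre products of affine schemes -/

section Tens

variable {A B R : Type u} [CommRing A] [CommRing B] [CommRing R]

/-- The ring homomorphism `B ⊗_A R → D`, `b ⊗ r ↦ x b * y r`, for `x` and `y` with commuting images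
that agree on `A`; the ring `D` need not be commutative. -/
def tensorLiftNC [Algebra A B] [Algebra A R] {D : Type*} [Ring D] (x : B →+* D) (y : R →+* D)
    (h : ∀ a, x (algebraMap A B a) = y (algebraMap A R a))
    (hc : ∀ b r, x b * y r = y r * x b) : TensorProduct A B R →+* D :=
  letI φ : TensorProduct A B R →+ D := TensorProduct.liftAddHom
    ((AddMonoidHom.mul.comp x.toAddMonoidHom).compl₂ y.toAddMonoidHom) (by
      intro a b r
      change x (a • b) * y r = x b * y (a • r)
      rw [Algebra.smul_def, Algebra.smul_def, mul_comm, map_mul, map_mul, h, mul_assoc])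
  have hφ : ∀ b r, φ (TensorProduct.tmul A b r) = x b * y r := fun b r => rfl
  { φ with
    map_one' := by
      change φ (TensorProduct.tmul A 1 1) = 1
      rw [hφ, map_one, map_one, mul_one]
    map_zero' := φ.map_zero
    map_mul' := by
      intro p q
      change φ (p * q) = φ p * φ q
      induction p using TensorProduct.induction_on with
      | zero => rw [zero_mul, map_zero, zero_mul]
      | add p p' hp hp' => rw [add_mul, map_add, map_add, hp, hp', add_mul]
      | tmul b r =>
        induction q using TensorProduct.induction_on with
        | zero => rw [mul_zero, map_zero, mul_zero]
        | add q q' hq hq' => rw [mul_add, map_add, map_add, hq, hq', mul_add]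
        | tmul b' r' =>
          rw [Algebra.TensorProduct.tmul_mul_tmul, hφ, hφ, hφ, map_mul, map_mul, mul_assoc,
            mul_assoc, ← mul_assoc (x b'), hc, mul_assoc] }

/-- For ring homomorphisms `f : A → B` and `g : A → R`, the ring `B ⊗_A R` formed with respect to
`f` and `g`, i.e. the ring of functions on the fibre product `Spec B ×_{Spec A} Spec R`. -/
def Tens (f : A →+* B) (g : A →+* R) : Type u :=
  @TensorProduct A _ B R _ _ f.toAlgebra.toModule g.toAlgebra.toModule

variable (f : A →+* B) (g : A →+* R)

instance : CommRing (Tens f g) :=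
  @Algebra.TensorProduct.instCommRing A B R _ _ f.toAlgebra _ g.toAlgebra

namespace Tens

/-- `b ↦ b ⊗ 1`, corresponding to the first projection. -/
def inl : B →+* Tens f g :=
  letI := f.toAlgebra
  letI := g.toAlgebra
  (Algebra.TensorProduct.includeLeftRingHom : B →+* TensorProduct A B R)

/-- `r ↦ 1 ⊗ r`, corresponding to the second projection. -/
def inr : R →+* Tens f g :=
  letI := f.toAlgebra
  letI := g.toAlgebra
  (Algebra.TensorProduct.includeRight : R →ₐ[A] TensorProduct A B R).toRingHom

theorem inl_comp : (inl f g).comp f = (inr f g).comp g := by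
  let _ := f.toAlgebra
  let _ := g.toAlgebra
  ext a
  exact (Algebra.TensorProduct.algebraMap_apply (S := A) (A := B) (B := R) a).symm.trans
    ((Algebra.TensorProduct.includeRight : R →ₐ[A] TensorProduct A B R).commutes a).symm

@[simp] theorem inl_apply_base (a : A) : inl f g (f a) = inr f g (g a) :=
  RingHom.congr_fun (inl_comp f g) a

variable {f g}

theorem induction {P : Tens f g → Prop} (z : Tens f g)
    (mul : ∀ b r, P (inl f g b * inr f g r)) (add : ∀ x y, P x → P y → P (x + y)) : P z := by
  let _ := f.toAlgebra
  let _ := g.toAlgebra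
  refine TensorProduct.induction_on (motive := P) z ?_ (fun b r => ?_) add
  · have := mul 0 0
    rwa [map_zero, zero_mul] at this
  · have h : (inl f g b * inr f g r : Tens f g) =
        (TensorProduct.tmul A b r : TensorProduct A B R) := by
      refine (Algebra.TensorProduct.tmul_mul_tmul (R := A) b 1 1 r).trans ?_
      rw [mul_one, one_mul]
    have := mul b r
    rwa [h] at this

theorem hom_ext {D : Type*} [Semiring D] {x y : Tens f g →+* D}
    (h₁ : x.comp (inl f g) = y.comp (inl f g)) (h₂ : x.comp (inr f g) = y.comp (inr f g)) :
    x = y := by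
  ext z
  induction z using induction with
  | mul b r =>
    rw [map_mul, map_mul]
    exact congrArg₂ (· * ·) (RingHom.congr_fun h₁ b) (RingHom.congr_fun h₂ r)
  | add p q hp hq => rw [map_add, map_add, hp, hq]

/-- The homomorphism `B ⊗_A R → D` determined by two homomorphisms with commuting images that
agree on `A`; the ring `D` need not be commutative. -/
def liftNC {D : Type*} [Ring D] (x : B →+* D) (y : R →+* D) (h : ∀ a, x (f a) = y (g a))
    (hc : ∀ b r, x b * y r = y r * x b) : Tens f g →+* D :=
  @tensorLiftNC A B R _ _ _ f.toAlgebra g.toAlgebra D _ x y h hc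

@[simp] theorem liftNC_inl {D : Type*} [Ring D] (x : B →+* D) (y : R →+* D) (h hc) (b : B) :
    (liftNC (f := f) (g := g) x y h hc) (inl f g b) = x b := by
  change x b * y 1 = x b
  rw [map_one, mul_one]

@[simp] theorem liftNC_inr {D : Type*} [Ring D] (x : B →+* D) (y : R →+* D) (h hc) (r : R) :
    (liftNC (f := f) (g := g) x y h hc) (inr f g r) = y r := by
  change x 1 * y r = y r
  rw [map_one, one_mul]

/-- The homomorphism `B ⊗_A R → D`, `b ⊗ r ↦ x b * y r`, for commutative `D`; it corresponds to
the morphism `Spec D → Spec B ×_{Spec A} Spec R` with components `x` and `y`. -/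
def lift {D : Type u} [CommRing D] (x : B →+* D) (y : R →+* D) (h : x.comp f = y.comp g) :
    Tens f g →+* D :=
  liftNC x y (RingHom.congr_fun h) (fun _ _ => mul_comm _ _)

@[simp] theorem lift_inl {D : Type u} [CommRing D] (x : B →+* D) (y : R →+* D) (h) (b : B) :
    (lift (f := f) (g := g) x y h) (inl f g b) = x b := liftNC_inl ..

@[simp] theorem lift_inr {D : Type u} [CommRing D] (x : B →+* D) (y : R →+* D) (h) (r : R) :
    (lift (f := f) (g := g) x y h) (inr f g r) = y r := liftNC_inr ..

end Tens

end Tens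

/-! ### Affine groupoids over an affine scheme -/

/-- An affine groupoid `G ⇉ S` with `S = Spec A` and `G = Spec B`, described by the comorphisms of
its structure maps: the two projections `p₁, p₂ : G → S`, the unit `1 : S → G`, the multiplication
`mult : G ×_{p₂,S,p₁} G → G` and the inversion `γ : G → G`. A point `g` of `G` is thought of as an
arrow with ends `p₁ g` and `p₂ g`, and `g h` is defined when `p₂ g = p₁ h`. -/
structure AffineGroupoid (A B : Type u) [CommRing A] [CommRing B] where
  p₁ : A →+* B
  p₂ : A →+* B
  one : B →+* A
  mult : B →+* Tens p₂ p₁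
  inv : B →+* B
  one_p₁ : one.comp p₁ = RingHom.id A
  one_p₂ : one.comp p₂ = RingHom.id A
  mult_p₁ : mult.comp p₁ = (Tens.inl p₂ p₁).comp p₁
  mult_p₂ : mult.comp p₂ = (Tens.inr p₂ p₁).comp p₂
  inv_p₁ : inv.comp p₁ = p₂
  inv_p₂ : inv.comp p₂ = p₁
  /-- `1_{p₁ g} * g = g` -/
  one_mult : (Tens.lift (p₁.comp one) (RingHom.id B)
    (by rw [RingHom.comp_assoc, one_p₂]; rfl)).comp mult = RingHom.id B
  /-- `g * 1_{p₂ g} = g` -/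
  mult_one : (Tens.lift (RingHom.id B) (p₂.comp one)
    (by rw [RingHom.comp_assoc, one_p₁]; rfl)).comp mult = RingHom.id B
  /-- `g * (h * k) = (g * h) * k`, on the scheme `G ×_S (G ×_S G)` -/
  mult_assoc :
    (Tens.lift (Tens.inl p₂ ((Tens.inl p₂ p₁).comp p₁))
        ((Tens.inr p₂ ((Tens.inl p₂ p₁).comp p₁)).comp mult)
        (by rw [RingHom.comp_assoc, mult_p₁, Tens.inl_comp])).comp mult =
    (Tens.lift
        ((Tens.lift (Tens.inl p₂ ((Tens.inl p₂ p₁).comp p₁))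
          ((Tens.inr p₂ ((Tens.inl p₂ p₁).comp p₁)).comp (Tens.inl p₂ p₁))
          (by rw [RingHom.comp_assoc, Tens.inl_comp])).comp mult)
        ((Tens.inr p₂ ((Tens.inl p₂ p₁).comp p₁)).comp (Tens.inr p₂ p₁))
        (by
          rw [RingHom.comp_assoc, mult_p₂]
          ext a
          simp)).comp mult
  /-- `g * g⁻¹ = 1_{p₁ g}` -/
  mult_inv : (Tens.lift (RingHom.id B) inv (by rw [inv_p₁]; rfl)).comp mult = p₁.comp one
  /-- `g⁻¹ * g = 1_{p₂ g}` -/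
  inv_mult : (Tens.lift inv (RingHom.id B) (by rw [inv_p₂]; rfl)).comp mult = p₂.comp one

/-! ### Base change of linear categories -/

section BaseChange

variable {A R R' R'' : Type u} [CommRing A] [CommRing R] [CommRing R'] [CommRing R'']

/-- Objects of the base change of the `A`-linear category `C` along `ψ : A → R`: objects of `C`
with an action of `R` whose restriction to `A` is the given action of `A` on objects of `C`. -/
structure BC (C : Type w) [Category.{v} C] [Preadditive C] [Linear A C] (ψ : A →+* R) where
  X : C
  ρ : R →+* End X
  compat : ∀ a : A, ρ (ψ a) = a • 𝟙 X

variable {C : Type w} [Category.{v} C] [Preadditive C] [Linear A C]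

namespace BC

variable {ψ : A →+* R} {ψ' : A →+* R'} {ψ'' : A →+* R''}

/-- The action of `r : R`, as a morphism of `C`. -/
abbrev act (M : BC C ψ) (r : R) : M.X ⟶ M.X := M.ρ r

theorem act_add (M : BC C ψ) (r r' : R) : M.act (r + r') = M.act r + M.act r' := map_add M.ρ r r'
theorem act_one (M : BC C ψ) : M.act 1 = 𝟙 M.X := map_one M.ρ
theorem act_mul (M : BC C ψ) (r r' : R) : M.act (r * r') = M.act r ≫ M.act r' := by
  rw [mul_comm]; exact map_mul M.ρ r' r
theorem act_base (M : BC C ψ) (a : A) : M.act (ψ a) = a • 𝟙 M.X := M.compat a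

/-- Morphisms of `C` commuting with the actions of `R`. -/
@[ext] structure Hom (M N : BC C ψ) where
  f : M.X ⟶ N.X
  comm : ∀ r : R, M.act r ≫ f = f ≫ N.act r

instance : Category (BC C ψ) where
  Hom := Hom
  id M := ⟨𝟙 M.X, fun r => by rw [Category.comp_id, Category.id_comp]⟩
  comp a b := ⟨a.f ≫ b.f, fun r => by
    rw [← Category.assoc, a.comm, Category.assoc, b.comm, Category.assoc]⟩

@[ext] theorem hom_ext {M N : BC C ψ} {a b : M ⟶ N} (h : a.f = b.f) : a = b := Hom.ext h
@[simp] theorem id_f (M : BC C ψ) : Hom.f (𝟙 M) = 𝟙 M.X := rfl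
@[simp] theorem comp_f {M N P : BC C ψ} (a : M ⟶ N) (b : N ⟶ P) : (a ≫ b).f = a.f ≫ b.f := rfl

/-- The functor forgetting the action of `R`: the direct image `C ×_S S' ⥤ C`. -/
@[simps] def push (ψ : A →+* R) : BC C ψ ⥤ C where
  obj M := M.X
  map a := a.f

/-- The direct image for `f : R → R'` over `A`: restriction of the action from `R'` to `R`. -/
@[simps] def restr (f : R →+* R') (hf : f.comp ψ = ψ') : BC C ψ' ⥤ BC C ψ where
  obj N := ⟨N.X, N.ρ.comp f, fun a =>
    (congrArg N.ρ (RingHom.congr_fun hf a)).trans (N.compat a)⟩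
  map a := ⟨a.f, fun r => a.comm (f r)⟩

/-- `C` as its own base change along the identity of `A` (this is an equivalence). -/
@[simps] def ofC (A : Type u) [CommRing A] [Linear A C] : C ⥤ BC C (RingHom.id A) where
  obj X := ⟨X, (algebraMap A (End X)), fun a => Algebra.algebraMap_eq_smul_one a⟩
  map {X Y} f := ⟨f, fun r => by
    have h : ∀ Z : C, (algebraMap A (End Z) r : Z ⟶ Z) = r • 𝟙 Z :=
      fun Z => Algebra.algebraMap_eq_smul_one r
    change (algebraMap A (End X) r : X ⟶ X) ≫ f = f ≫ (algebraMap A (End Y) r : Y ⟶ Y)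
    rw [h, h, Linear.smul_comp, Linear.comp_smul, Category.id_comp, Category.comp_id]⟩

end BC

end BaseChange

/-! ### Pullback functors -/

section Pull

variable {A R R' R'' : Type u} [CommRing A] [CommRing R] [CommRing R'] [CommRing R'']
variable {C : Type w} [Category.{v} C] [Abelian C] [Linear A C] [HasFilteredColimitsOfSize.{u, u} C]

instance : HasCoproducts.{u} C := hasCoproducts_of_finite_and_filtered

namespace BC

variable {ψ : A →+* R} {ψ' : A →+* R'} {ψ'' : A →+* R''}

/-- The relations `(b + b') ⊗ x = b ⊗ x + b' ⊗ x` and `b f(r) ⊗ x = b ⊗ r x` in the direct sum of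
copies of `M`, indexed by `b : R'`. -/
def tensRel (f : R →+* R') (M : BC C ψ) :
    (∐ fun _ : (R' × R') ⊕ (R' × R) => M.X) ⟶ (∐ fun _ : R' => M.X) :=
  Sigma.desc fun i => match i with
    | Sum.inl (b, b') => Sigma.ι (fun _ : R' => M.X) (b + b') -
        (Sigma.ι (fun _ : R' => M.X) b + Sigma.ι (fun _ : R' => M.X) b')
    | Sum.inr (b, r) => Sigma.ι (fun _ : R' => M.X) (b * f r) -
        M.act r ≫ Sigma.ι (fun _ : R' => M.X) b

/-- The object `R' ⊗_R M` of `C`, defined by generators and relations. -/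
def tens (f : R →+* R') (M : BC C ψ) : C := cokernel (tensRel f M)

/-- The quotient map onto `R' ⊗_R M`. -/
def tensπ (f : R →+* R') (M : BC C ψ) : (∐ fun _ : R' => M.X) ⟶ tens f M :=
  cokernel.π (tensRel f M)

theorem tensRel_tensπ (f : R →+* R') (M : BC C ψ) : tensRel f M ≫ tensπ f M = 0 :=
  cokernel.condition _

/-- The map `x ↦ b ⊗ x` from `M` to `R' ⊗_R M`. -/
def tmk (f : R →+* R') (M : BC C ψ) (b : R') : M.X ⟶ tens f M :=
  Sigma.ι (fun _ : R' => M.X) b ≫ tensπ f M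

theorem tmk_add (f : R →+* R') (M : BC C ψ) (b b' : R') :
    tmk f M (b + b') = tmk f M b + tmk f M b' := by
  have h : Sigma.ι (fun _ : (R' × R') ⊕ (R' × R) => M.X) (Sum.inl (b, b')) ≫ tensRel f M ≫
      tensπ f M = 0 := by rw [tensRel_tensπ, comp_zero]
  rw [tensRel, Sigma.ι_desc_assoc, Preadditive.sub_comp, Preadditive.add_comp, sub_eq_zero] at h
  exact h

theorem tmk_mul (f : R →+* R') (M : BC C ψ) (b : R') (r : R) :
    tmk f M (b * f r) = M.act r ≫ tmk f M b := by
  have h : Sigma.ι (fun _ : (R' × R') ⊕ (R' × R) => M.X) (Sum.inr (b, r)) ≫ tensRel f M ≫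
      tensπ f M = 0 := by rw [tensRel_tensπ, comp_zero]
  rw [tensRel, Sigma.ι_desc_assoc, Preadditive.sub_comp, Category.assoc, sub_eq_zero] at h
  exact h

theorem tens_hom_ext {f : R →+* R'} {M : BC C ψ} {Y : C} {p q : tens f M ⟶ Y}
    (h : ∀ b, tmk f M b ≫ p = tmk f M b ≫ q) : p = q := by
  have h' : tensπ f M ≫ p = tensπ f M ≫ q := Sigma.hom_ext _ _ fun b => by
    have := h b
    rwa [tmk, Category.assoc, Category.assoc] at this
  exact coequalizer.hom_ext h'

/-- A family of morphisms `φ b : M → Y` respecting the relations defines `R' ⊗_R M → Y`. -/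
def tensDesc (f : R →+* R') (M : BC C ψ) {Y : C} (φ : R' → (M.X ⟶ Y))
    (h₁ : ∀ b b', φ (b + b') = φ b + φ b') (h₂ : ∀ b r, φ (b * f r) = M.act r ≫ φ b) :
    tens f M ⟶ Y :=
  cokernel.desc _ (Sigma.desc φ) (by
    refine Sigma.hom_ext _ _ fun i => ?_
    rcases i with ⟨b, b'⟩ | ⟨b, r⟩
    · simp [tensRel, h₁]
    · simp [tensRel, h₂])

@[simp] theorem tmk_tensDesc (f : R →+* R') (M : BC C ψ) {Y : C} (φ : R' → (M.X ⟶ Y)) (h₁ h₂) (b : R') :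
    tmk f M b ≫ tensDesc f M φ h₁ h₂ = φ b := by
  have h : tensπ f M ≫ tensDesc f M φ h₁ h₂ = Sigma.desc φ := cokernel.π_desc _ _ _
  rw [tmk, Category.assoc, h, Sigma.ι_desc]

@[simp] theorem tmk_tensDesc_assoc (f : R →+* R') (M : BC C ψ) {Y Z : C} (φ : R' → (M.X ⟶ Y))
    (h₁ h₂) (b : R') (k : Y ⟶ Z) : tmk f M b ≫ tensDesc f M φ h₁ h₂ ≫ k = φ b ≫ k := by
  rw [← Category.assoc, tmk_tensDesc]

/-- The action of `c : R'` on `R' ⊗_R M`, `b ⊗ x ↦ c b ⊗ x`. -/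
def tensAct (f : R →+* R') (M : BC C ψ) (c : R') : tens f M ⟶ tens f M :=
  tensDesc f M (fun b => tmk f M (c * b))
    (fun b b' => by rw [mul_add, tmk_add]) (fun b r => by rw [← mul_assoc, tmk_mul])

@[simp] theorem tmk_tensAct (f : R →+* R') (M : BC C ψ) (b c : R') :
    tmk f M b ≫ tensAct f M c = tmk f M (c * b) := tmk_tensDesc ..

@[simp] theorem tmk_tensAct_assoc (f : R →+* R') (M : BC C ψ) (b c : R') {Z : C}
    (k : tens f M ⟶ Z) : tmk f M b ≫ tensAct f M c ≫ k = tmk f M (c * b) ≫ k := by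
  rw [← Category.assoc, tmk_tensAct]

theorem tmk_zero (f : R →+* R') (M : BC C ψ) : tmk f M 0 = 0 := by
  have h := tmk_add f M 0 0
  rwa [add_zero, left_eq_add] at h

/-- `R' ⊗_R M` with the action of `R'` on the first factor. -/
def pullObj (f : R →+* R') (hf : f.comp ψ = ψ') (M : BC C ψ) : BC C ψ' where
  X := tens f M
  ρ :=
    { toFun := tensAct f M
      map_one' := show tensAct f M 1 = 𝟙 _ from tens_hom_ext fun b => by simp
      map_mul' := fun c d => show tensAct f M (c * d) = tensAct f M d ≫ tensAct f M c from
        tens_hom_ext fun b => by simp [mul_assoc]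
      map_zero' := show tensAct f M 0 = 0 from tens_hom_ext fun b => by simp [tmk_zero]
      map_add' := fun c d => show tensAct f M (c + d) = tensAct f M c + tensAct f M d from
        tens_hom_ext fun b => by simp [add_mul, tmk_add] }
  compat := fun a => show tensAct f M (ψ' a) = a • 𝟙 _ from tens_hom_ext fun b => by
    rw [tmk_tensAct, ← hf, mul_comm, RingHom.comp_apply, tmk_mul, act_base, Linear.smul_comp,
      Category.id_comp, Linear.comp_smul, Category.comp_id]

/-- The universal map `x ↦ 1 ⊗ x` from `M` to `R' ⊗_R M`. -/
def unitAux (f : R →+* R') (hf : f.comp ψ = ψ') (M : BC C ψ) : M.X ⟶ (pullObj f hf M).X :=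
  tmk f M 1

theorem unitAux_comm (f : R →+* R') (hf : f.comp ψ = ψ') (M : BC C ψ) (r : R) :
    M.act r ≫ unitAux f hf M = unitAux f hf M ≫ (pullObj f hf M).act (f r) := by
  change M.act r ≫ tmk f M 1 = tmk f M 1 ≫ tensAct f M (f r)
  rw [tmk_tensAct, ← tmk_mul, mul_comm]

/-- The map `b ⊗ x ↦ b g(x)`. -/
def descAuxHom (f : R →+* R') (M : BC C ψ) (N : BC C ψ') (g : M.X ⟶ N.X)
    (hg : ∀ r, M.act r ≫ g = g ≫ N.act (f r)) : tens f M ⟶ N.X :=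
  tensDesc f M (fun b => g ≫ N.act b) (fun b b' => by rw [act_add, Preadditive.comp_add])
    (fun b r => by rw [mul_comm, act_mul, ← Category.assoc, ← hg, Category.assoc])

theorem tmk_descAuxHom (f : R →+* R') (M : BC C ψ) (N : BC C ψ') (g : M.X ⟶ N.X) (hg) (b : R') :
    tmk f M b ≫ descAuxHom f M N g hg = g ≫ N.act b := tmk_tensDesc ..

/-- A morphism `g : M → N` in `C` which is linear along `f : R → R'` extends uniquely to an
`R'`-linear morphism `R' ⊗_R M → N`. -/
def descAux (f : R →+* R') (hf : f.comp ψ = ψ') {M : BC C ψ} {N : BC C ψ'} (g : M.X ⟶ N.X)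
    (hg : ∀ r, M.act r ≫ g = g ≫ N.act (f r)) : pullObj f hf M ⟶ N :=
  ⟨descAuxHom f M N g hg, fun r =>
    show tensAct f M r ≫ descAuxHom f M N g hg = descAuxHom f M N g hg ≫ N.act r from
      tens_hom_ext fun b => by
        rw [tmk_tensAct_assoc, tmk_descAuxHom, ← Category.assoc, tmk_descAuxHom, mul_comm,
          act_mul, Category.assoc]⟩

@[simp] theorem unitAux_descAux (f : R →+* R') (hf : f.comp ψ = ψ') {M : BC C ψ} {N : BC C ψ'}
    (g : M.X ⟶ N.X) (hg) : unitAux f hf M ≫ (descAux f hf (N := N) g hg).f = g := by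
  refine (tmk_descAuxHom f M N g hg 1).trans ?_
  rw [act_one, Category.comp_id]

@[simp] theorem unitAux_descAux_assoc (f : R →+* R') (hf : f.comp ψ = ψ') {M : BC C ψ}
    {N : BC C ψ'} (g : M.X ⟶ N.X) (hg) {Z : C} (k : N.X ⟶ Z) :
    unitAux f hf M ≫ (descAux f hf (N := N) g hg).f ≫ k = g ≫ k := by
  rw [← Category.assoc, unitAux_descAux]

theorem hom_extAux {f : R →+* R'} {hf : f.comp ψ = ψ'} {M : BC C ψ} {N : BC C ψ'}
    {p q : pullObj f hf M ⟶ N} (h : unitAux f hf M ≫ p.f = unitAux f hf M ≫ q.f) : p = q := by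
  refine hom_ext (tens_hom_ext fun b => ?_)
  have hb : tmk f M b = unitAux f hf M ≫ (pullObj f hf M).act b := by
    change tmk f M b = tmk f M 1 ≫ tensAct f M b
    rw [tmk_tensAct, mul_one]
  have key : ∀ k : pullObj f hf M ⟶ N,
      tmk f M b ≫ k.f = (unitAux f hf M ≫ k.f) ≫ N.act b := by
    intro k
    refine (congrArg (· ≫ k.f) hb).trans ?_
    rw [Category.assoc, Category.assoc, k.comm b]
  exact (key p).trans ((congrArg (· ≫ N.act b) h).trans (key q).symm)

/-- The pullback functor `M ↦ R' ⊗_R M` for `f : R → R'` over `A`. -/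
def pull (f : R →+* R') (hf : f.comp ψ = ψ') : BC C ψ ⥤ BC C ψ' where
  obj M := pullObj f hf M
  map {M N} a := descAux f hf (a.f ≫ unitAux f hf N) (fun r => by
    rw [← Category.assoc, a.comm, Category.assoc, unitAux_comm, Category.assoc])
  map_id M := hom_extAux (by simp)
  map_comp a b := hom_extAux (by simp)

/-- The universal map `x ↦ 1 ⊗ x` from `M` to `f^* M`. -/
def pullUnit (f : R →+* R') (hf : f.comp ψ = ψ') (M : BC C ψ) : M.X ⟶ ((pull f hf).obj M).X :=
  unitAux f hf M

theorem pullUnit_comm (f : R →+* R') (hf : f.comp ψ = ψ') (M : BC C ψ) (r : R) :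
    M.act r ≫ pullUnit f hf M = pullUnit f hf M ≫ ((pull f hf).obj M).act (f r) :=
  unitAux_comm f hf M r

/-- A morphism `g : M → N` in `C` which is linear along `f : R → R'` extends uniquely to an
`R'`-linear morphism `f^* M → N`. -/
def pullDesc (f : R →+* R') (hf : f.comp ψ = ψ') {M : BC C ψ} {N : BC C ψ'} (g : M.X ⟶ N.X)
    (hg : ∀ r, M.act r ≫ g = g ≫ N.act (f r)) : (pull f hf).obj M ⟶ N :=
  descAux f hf g hg

@[simp] theorem pullUnit_pullDesc (f : R →+* R') (hf : f.comp ψ = ψ') {M : BC C ψ} {N : BC C ψ'}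
    (g : M.X ⟶ N.X) (hg) : pullUnit f hf M ≫ (pullDesc f hf (N := N) g hg).f = g :=
  unitAux_descAux f hf g hg

@[simp] theorem pullUnit_map (f : R →+* R') (hf : f.comp ψ = ψ') {M N : BC C ψ} (a : M ⟶ N) :
    pullUnit f hf M ≫ ((pull f hf).map a).f = a.f ≫ pullUnit f hf N :=
  unitAux_descAux f hf _ _

theorem pull_hom_ext {f : R →+* R'} {hf : f.comp ψ = ψ'} {M : BC C ψ} {N : BC C ψ'}
    {p q : (pull f hf).obj M ⟶ N} (h : pullUnit f hf M ≫ p.f = pullUnit f hf M ≫ q.f) : p = q :=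
  hom_extAux h

theorem pullUnit_comp_comm (f : R →+* R') (hf : f.comp ψ = ψ') {M : BC C ψ} {N : BC C ψ'}
    (p : (pull f hf).obj M ⟶ N) (r : R) :
    M.act r ≫ pullUnit f hf M ≫ p.f = (pullUnit f hf M ≫ p.f) ≫ N.act (f r) := by
  rw [← Category.assoc, pullUnit_comm, Category.assoc, p.comm, Category.assoc]

theorem pullUnit_naturality (f : R →+* R') (hf : f.comp ψ = ψ') {M M' : BC C ψ} {N N' : BC C ψ'}
    (a : M ⟶ M') (p : (pull f hf).obj M ⟶ N) (p' : (pull f hf).obj M' ⟶ N') (c : N ⟶ N')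
    (h : (pull f hf).map a ≫ p' = p ≫ c) :
    a.f ≫ pullUnit f hf M' ≫ p'.f = (pullUnit f hf M ≫ p.f) ≫ c.f := by
  rw [← Category.assoc, ← pullUnit_map, Category.assoc, ← comp_f, h, comp_f, Category.assoc]

theorem map_pullDesc (f : R →+* R') (hf : f.comp ψ = ψ') {M' M : BC C ψ} {N : BC C ψ'}
    (a : M' ⟶ M) (g : M.X ⟶ N.X) (hg) (hg') : (pull f hf).map a ≫ pullDesc f hf (N := N) g hg =
      pullDesc f hf (N := N) (a.f ≫ g) hg' :=
  pull_hom_ext (by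
    rw [comp_f, ← Category.assoc, pullUnit_map, Category.assoc, pullUnit_pullDesc,
      pullUnit_pullDesc])

/-- Morphisms `f^* M → N` are the same as morphisms `M → f_* N`. -/
@[simps] def pullEquiv (f : R →+* R') (hf : f.comp ψ = ψ') (M : BC C ψ) (N : BC C ψ') :
    ((pull f hf).obj M ⟶ N) ≃ (M ⟶ (restr f hf).obj N) where
  toFun p := ⟨pullUnit f hf M ≫ p.f, pullUnit_comp_comm f hf p⟩
  invFun q := pullDesc f hf q.f q.comm
  left_inv _ := pull_hom_ext (pullUnit_pullDesc f hf (N := N) _ _)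
  right_inv _ := hom_ext (pullUnit_pullDesc f hf (N := N) _ _)

/-- The pullback functor is left adjoint to the direct image functor. -/
def pullAdj (f : R →+* R') (hf : f.comp ψ = ψ') :
    pull (C := C) f hf ⊣ restr f hf :=
  Adjunction.mkOfHomEquiv
    { homEquiv := pullEquiv f hf
      homEquiv_naturality_left_symm := fun {_ _ N} a b =>
        (map_pullDesc f hf (N := N) a b.f b.comm (a ≫ b).comm).symm
      homEquiv_naturality_right := fun _ _ => hom_ext (Category.assoc _ _ _).symm }

/-- The pullback functor `X ↦ R ⊗_A X` from `C` to its base change along `ψ : A → R`. -/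
def pullC (ψ : A →+* R) : C ⥤ BC C ψ := ofC A ⋙ pull ψ (RingHom.comp_id ψ)

/-- The universal map `x ↦ 1 ⊗ x` from `X` to `R ⊗_A X`. -/
def pullCUnit (ψ : A →+* R) (X : C) : X ⟶ ((pullC ψ).obj X).X :=
  pullUnit ψ (RingHom.comp_id ψ) ((ofC A).obj X)

/-- A morphism `X → N` in `C` extends uniquely to an `R`-linear morphism `R ⊗_A X → N`. -/
def pullCDesc (ψ : A →+* R) {X : C} {N : BC C ψ} (g : X ⟶ N.X) : (pullC ψ).obj X ⟶ N :=
  pullDesc (M := (ofC A).obj X) ψ (RingHom.comp_id ψ) g (fun a =>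
    (congrArg (· ≫ g) (act_base ((ofC A).obj X) a : (_ : X ⟶ X) = a • 𝟙 X)).trans
      ((show (a • 𝟙 X) ≫ g = g ≫ (a • 𝟙 N.X) by
        rw [Linear.smul_comp, Linear.comp_smul, Category.id_comp, Category.comp_id]).trans
      (congrArg (g ≫ ·) (act_base N a)).symm))

/-- The canonical isomorphism `h^* M ≅ g^* (f^* M)` for `h = g ∘ f`. -/
def pullComp (f : R →+* R') (hf : f.comp ψ = ψ') (g : R' →+* R'') (hg : g.comp ψ' = ψ'')
    (h : R →+* R'') (hh : h.comp ψ = ψ'') (e : g.comp f = h) (M : BC C ψ) :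
    (pull h hh).obj M ⟶ (pull g hg).obj ((pull f hf).obj M) :=
  pullDesc h hh (pullUnit f hf M ≫ pullUnit g hg ((pull f hf).obj M)) (fun r => by
    rw [← Category.assoc, pullUnit_comm, Category.assoc, pullUnit_comm, Category.assoc, ← e]
    rfl)

/-- The canonical isomorphism `id^* M ≅ M`. -/
def pullId (M : BC C ψ) : (pull (RingHom.id R) (RingHom.id_comp ψ)).obj M ⟶ M :=
  pullDesc _ _ (𝟙 M.X) (fun r => by rw [Category.comp_id, Category.id_comp]; rfl)

end BC

end Pull

/-! ### Actions of groupoids on categories and equivariant objects -/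

section Action

variable {A B R R' : Type u} [CommRing A] [CommRing B] [CommRing R] [CommRing R']

namespace AffineGroupoid

variable (G : AffineGroupoid A B)

/-- The comorphism of the map `id × f : G ×_S S'' → G ×_S S'` for `f : S'' → S'` over `S`. -/
def idTimes {ψ : A →+* R} {ψ' : A →+* R'} (f : R →+* R') (hf : f.comp ψ = ψ') :
    Tens G.p₂ ψ →+* Tens G.p₂ ψ' :=
  Tens.lift (Tens.inl _ _) ((Tens.inr _ _).comp f)
    (by rw [RingHom.comp_assoc, hf, Tens.inl_comp])

/-- The comorphism of the map `G ×_S (G ×_S S') → G ×_S G`, `(g, (h, x)) ↦ (g, h)`. -/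
def fstTwo (ψ : A →+* R) : Tens G.p₂ G.p₁ →+* Tens G.p₂ ((Tens.inl G.p₂ ψ).comp G.p₁) :=
  Tens.lift (Tens.inl _ _) ((Tens.inr _ _).comp (Tens.inl _ _))
    (by rw [RingHom.comp_assoc, Tens.inl_comp])

/-- The comorphism of the map `mult × id : G ×_S (G ×_S S') → G ×_S S'`,
`(g, (h, x)) ↦ (g h, x)`. -/
def multTimes (ψ : A →+* R) : Tens G.p₂ ψ →+* Tens G.p₂ ((Tens.inl G.p₂ ψ).comp G.p₁) :=
  Tens.lift ((G.fstTwo ψ).comp G.mult) ((Tens.inr _ _).comp (Tens.inr _ _)) (by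
    rw [RingHom.comp_assoc, G.mult_p₂]
    ext a
    simp [fstTwo])

/-- The comorphism of the map `1 × id : S' → G ×_S S'`, `x ↦ (1, x)`. -/
def oneTimes (ψ : A →+* R) : Tens G.p₂ ψ →+* R :=
  Tens.lift (ψ.comp G.one) (RingHom.id R) (by rw [RingHom.comp_assoc, G.one_p₂]; rfl)

/-- The comorphism of the map `id × 1 : G → G ×_S G`, `g ↦ (g, 1)`. -/
def timesOne : Tens G.p₂ G.p₁ →+* B :=
  Tens.lift (RingHom.id B) (G.p₂.comp G.one) (by rw [RingHom.comp_assoc, G.one_p₁]; rfl)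

theorem idTimes_base {ψ : A →+* R} {ψ' : A →+* R'} (f : R →+* R') (hf : f.comp ψ = ψ') :
    (G.idTimes f hf).comp ((Tens.inl G.p₂ ψ).comp G.p₁) = (Tens.inl G.p₂ ψ').comp G.p₁ := by
  ext a; simp [idTimes]

theorem multTimes_base (ψ : A →+* R) : (G.multTimes ψ).comp ((Tens.inl G.p₂ ψ).comp G.p₁) =
    (Tens.inl G.p₂ ((Tens.inl G.p₂ ψ).comp G.p₁)).comp G.p₁ := by
  ext a
  have h : G.mult (G.p₁ a) = Tens.inl _ _ (G.p₁ a) := RingHom.congr_fun G.mult_p₁ a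
  simp [multTimes, fstTwo, h]

theorem oneTimes_base (ψ : A →+* R) : (G.oneTimes ψ).comp ((Tens.inl G.p₂ ψ).comp G.p₁) = ψ := by
  ext a
  have h : G.one (G.p₁ a) = a := RingHom.congr_fun G.one_p₁ a
  simp [oneTimes, h]

theorem timesOne_base : G.timesOne.comp ((Tens.inl G.p₂ G.p₁).comp G.p₁) = G.p₁ := by
  ext a; simp [timesOne]

theorem assoc_eq : (G.idTimes G.mult G.mult_p₁).comp G.mult = (G.multTimes G.p₁).comp G.mult :=
  G.mult_assoc

theorem triple_base : ((G.multTimes G.p₁).comp G.mult).comp G.p₁ =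
    (Tens.inl G.p₂ ((Tens.inl G.p₂ G.p₁).comp G.p₁)).comp G.p₁ := by
  rw [RingHom.comp_assoc, G.mult_p₁, multTimes_base]

end AffineGroupoid

variable (G : AffineGroupoid A B)
variable (C : Type w) [Category.{v} C] [Abelian C] [Linear A C] [HasFilteredColimitsOfSize.{u, u} C]

open BC

/-- A functor `act^* : C → C ×_{S,p₁} G` which is `O_S`-linear when the target is regarded as a
category over `S` via `p₂`. -/
structure ActFunctor where
  act : C ⥤ BC C G.p₁
  map_add : ∀ {X Y : C} (f g : X ⟶ Y), (act.map (f + g)).f = (act.map f).f + (act.map g).f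
  map_smul : ∀ {X Y : C} (a : A) (f : X ⟶ Y),
    (act.map (a • f)).f = (act.map f).f ≫ (act.obj Y).act (G.p₂ a)

namespace ActFunctor

variable {G C} (F : ActFunctor G C) {ψ : A →+* R} {ψ' : A →+* R'}

theorem map_zero {X Y : C} : (F.act.map (0 : X ⟶ Y)).f = 0 := by
  have h := F.map_add (0 : X ⟶ Y) 0
  rwa [add_zero, left_eq_add] at h

theorem map_id_f (X : C) : (F.act.map (𝟙 X)).f = 𝟙 _ := by rw [F.act.map_id, id_f]

theorem map_comp_f {X Y Z : C} (f : X ⟶ Y) (g : Y ⟶ Z) :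
    (F.act.map (f ≫ g)).f = (F.act.map f).f ≫ (F.act.map g).f := by rw [F.act.map_comp, comp_f]

/-- The action of `R` on `act^*(M)` by functoriality, for an object `M` with an action of `R`. -/
def transport (M : BC C ψ) : R →+* End (F.act.obj M.X).X where
  toFun r := (F.act.map (M.act r)).f
  map_one' := by rw [act_one, map_id_f]; rfl
  map_mul' r s := by rw [mul_comm, act_mul, map_comp_f]; rfl
  map_zero' := by
    rw [show M.act 0 = 0 from RingHom.map_zero M.ρ]; exact F.map_zero
  map_add' r s := by rw [act_add]; exact F.map_add _ _

theorem transport_base (M : BC C ψ) (a : A) :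
    (F.act.obj M.X).ρ (G.p₂ a) = F.transport M (ψ a) := by
  change (F.act.obj M.X).act (G.p₂ a) = (F.act.map (M.act (ψ a))).f
  rw [act_base, F.map_smul, map_id_f, Category.id_comp]

theorem transport_comm (M : BC C ψ) (b : B) (r : R) :
    (F.act.obj M.X).ρ b * F.transport M r = F.transport M r * (F.act.obj M.X).ρ b :=
  ((F.act.map (M.act r)).comm b).symm

/-- The object `act^*(M)` of `C ×_{S,p₁} (G ×_{p₂,S} S')`, for `M` in `C ×_S S'`: the functions on
`G` act since `act^*(M)` lies in `C ×_{S,p₁} G`, those on `S'` act by functoriality. -/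
abbrev actObj (ψ : A →+* R) (M : BC C ψ) : BC C ((Tens.inl G.p₂ ψ).comp G.p₁) where
  X := (F.act.obj M.X).X
  ρ := Tens.liftNC (F.act.obj M.X).ρ (F.transport M)
    (F.transport_base M) (F.transport_comm M)
  compat a := (Tens.liftNC_inl _ _ _ _ _).trans ((F.act.obj M.X).compat a)

theorem actObj_inl (M : BC C ψ) (b : B) :
    (F.actObj ψ M).act (Tens.inl G.p₂ ψ b) = (F.act.obj M.X).act b :=
  Tens.liftNC_inl (F.act.obj M.X).ρ (F.transport M) (F.transport_base M) (F.transport_comm M) b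

theorem actObj_inr (M : BC C ψ) (r : R) :
    (F.actObj ψ M).act (Tens.inr G.p₂ ψ r) = (F.act.map (M.act r)).f :=
  Tens.liftNC_inr (F.act.obj M.X).ρ (F.transport M) (F.transport_base M) (F.transport_comm M) r

/-- Linearity over `B ⊗_A R` can be checked on the two factors. -/
theorem comm_of_tens {T : Type u} [CommRing T] {χ : A →+* T} (M : BC C ψ) (N : BC C χ)
    (z : Tens G.p₂ ψ →+* T) (g : (F.actObj ψ M).X ⟶ N.X)
    (h₁ : ∀ b, (F.act.obj M.X).act b ≫ g = g ≫ N.act (z (Tens.inl _ _ b)))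
    (h₂ : ∀ r, (F.act.map (M.act r)).f ≫ g = g ≫ N.act (z (Tens.inr _ _ r)))
    (t : Tens G.p₂ ψ) : (F.actObj ψ M).act t ≫ g = g ≫ N.act (z t) := by
  induction t using Tens.induction with
  | mul b r =>
    rw [act_mul, RingHom.map_mul, act_mul, actObj_inl, actObj_inr, ← Category.assoc, ← h₁,
      Category.assoc, Category.assoc, ← h₂]
  | add x y hx hy =>
    rw [act_add, RingHom.map_add, act_add, Preadditive.add_comp, Preadditive.comp_add, hx, hy]

/-- The functor `act^* × id_{S'} : C ×_S S' → C ×_{S,p₁} (G ×_{p₂,S} S')`. -/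
def actBC (ψ : A →+* R) : BC C ψ ⥤ BC C ((Tens.inl G.p₂ ψ).comp G.p₁) where
  obj M := F.actObj ψ M
  map {M N} a := ⟨(F.act.map a.f).f, F.comm_of_tens M (F.actObj ψ N) (RingHom.id _) _
    (fun b => ((F.act.map a.f).comm b).trans
      (congrArg ((F.act.map a.f).f ≫ ·) (F.actObj_inl N b).symm))
    (fun r => by
      refine Eq.trans ?_ (congrArg ((F.act.map a.f).f ≫ ·) (F.actObj_inr N r).symm)
      rw [← map_comp_f, a.comm, map_comp_f])⟩
  map_id M := hom_ext (F.map_id_f M.X)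
  map_comp a b := hom_ext (F.map_comp_f a.f b.f)

/-- The base change morphism `(id × f)^* (act^* × id)(M) → (act^* × id)(f^* M)` for
`f : S'' → S'` over `S`. -/
def baseChange (f : R →+* R') (hf : f.comp ψ = ψ') (M : BC C ψ) :
    (pull (G.idTimes f hf) (G.idTimes_base f hf)).obj ((F.actBC ψ).obj M) ⟶
      (F.actBC ψ').obj ((pull f hf).obj M) :=
  pullDesc _ _ (F.act.map (pullUnit f hf M)).f
    (F.comm_of_tens M (F.actObj ψ' ((pull f hf).obj M)) _ _
      (fun b => by
        rw [(F.act.map _).comm, AffineGroupoid.idTimes, Tens.lift_inl, actObj_inl])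
      (fun r => by
        rw [AffineGroupoid.idTimes, Tens.lift_inr, RingHom.comp_apply, actObj_inr, ← map_comp_f,
          ← map_comp_f, pullUnit_comm]))

/-- The base change morphism `pr₁^* act^*(X) → (act^* × id)(ψ^* X)` for `ψ : S' → S`, where
`pr₁ : G ×_S S' → G`. -/
def baseChangeBase (ψ : A →+* R) (X : C) :
    (pull (Tens.inl G.p₂ ψ) rfl).obj (F.act.obj X) ⟶ (F.actBC ψ).obj ((pullC ψ).obj X) :=
  pullDesc _ _ (N := F.actObj ψ ((pullC ψ).obj X)) (F.act.map (pullCUnit ψ X)).f (fun b => by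
    rw [(F.act.map _).comm, actObj_inl])

/-- The base change morphism `(id × 1)^* (act^* × id_G)(M) → act^*(1^* M)` for the unit
`1 : S → G`. -/
def baseChangeOne (M : BC C G.p₁) :
    (pull G.timesOne G.timesOne_base).obj ((F.actBC G.p₁).obj M) ⟶
      F.act.obj ((pull G.one G.one_p₁).obj M).X :=
  pullDesc _ _ (F.act.map (pullUnit G.one G.one_p₁ M)).f
    (F.comm_of_tens M (F.act.obj ((pull G.one G.one_p₁).obj M).X) _ _
      (fun b => by
        rw [(F.act.map _).comm, AffineGroupoid.timesOne, Tens.lift_inl]; rfl)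
      (fun r => by
        rw [AffineGroupoid.timesOne, Tens.lift_inr, RingHom.comp_apply, ← map_comp_f,
          pullUnit_comm, show ((pull G.one G.one_p₁).obj M).act (G.one r) = G.one r • 𝟙 _ from
            act_base (ψ := RingHom.id A) _ _, Linear.comp_smul, Category.comp_id, map_smul]))

end ActFunctor

/-- A functor `act^*` together with the unit constraint and the associativity constraint; their
compatibility is not yet required. -/
structure PreAction extends ActFunctor G C where
  /-- The unit constraint `1^* act^*(X) ≅ X`. -/
  unit : act ⋙ pull G.one G.one_p₁ ≅ ofC A
  /-- The associativity constraint `mult^* act^*(X) ≅ (act^* × id_G)(act^*(X))`. -/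
  assoc : act ⋙ pull G.mult G.mult_p₁ ≅ act ⋙ toActFunctor.actBC G.p₁

namespace PreAction

variable {G C} (F : PreAction G C) {ψ : A →+* R} {ψ' : A →+* R'}

/-- The morphism `act^*(X) → X` of `C` obtained from the unit constraint by adjunction. -/
def unitHom (X : C) : (F.act.obj X).X ⟶ X :=
  pullUnit G.one G.one_p₁ (F.act.obj X) ≫ (F.unit.hom.app X).f

/-- The morphism `act^*(X) → act^*(act^*(X))` of `C` obtained from the associativity constraint by
adjunction. -/
def assocHom (X : C) : (F.act.obj X).X ⟶ (F.act.obj (F.act.obj X).X).X :=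
  pullUnit G.mult G.mult_p₁ (F.act.obj X) ≫ (F.assoc.hom.app X).f

theorem unitHom_naturality {X Y : C} (f : X ⟶ Y) :
    (F.act.map f).f ≫ F.unitHom Y = F.unitHom X ≫ f := by
  exact pullUnit_naturality G.one G.one_p₁ (F.act.map f) (F.unit.hom.app X) (F.unit.hom.app Y)
    ((ofC A).map f) (F.unit.hom.naturality f)

theorem unitHom_comm (X : C) (b : B) :
    (F.act.obj X).act b ≫ F.unitHom X = F.unitHom X ≫ (G.one b • 𝟙 X) :=
  (pullUnit_comp_comm G.one G.one_p₁ (F.unit.hom.app X) b).trans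
    (congrArg (F.unitHom X ≫ ·) (act_base ((ofC A).obj X) (G.one b)))

theorem assocHom_naturality {X Y : C} (f : X ⟶ Y) :
    (F.act.map f).f ≫ F.assocHom Y = F.assocHom X ≫ (F.act.map (F.act.map f).f).f := by
  exact pullUnit_naturality G.mult G.mult_p₁ (F.act.map f) (F.assoc.hom.app X) (F.assoc.hom.app Y)
    ((F.actBC G.p₁).map (F.act.map f)) (F.assoc.hom.naturality f)

theorem assocHom_comm (X : C) (b : B) : (F.act.obj X).act b ≫ F.assocHom X =
    F.assocHom X ≫ (F.actObj G.p₁ (F.act.obj X)).act (G.mult b) :=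
  pullUnit_comp_comm G.mult G.mult_p₁ (F.assoc.hom.app X) b

theorem actObj_fstTwo (M : BC C ψ) (z : Tens G.p₂ G.p₁) :
    (F.actObj _ (F.actObj ψ M)).act (G.fstTwo ψ z) = (F.actObj G.p₁ (F.act.obj M.X)).act z := by
  have h := F.comm_of_tens (F.act.obj M.X) (F.actObj _ (F.actObj ψ M)) (G.fstTwo ψ) (𝟙 _)
    (fun b => by
      rw [AffineGroupoid.fstTwo, Tens.lift_inl, ActFunctor.actObj_inl]
      exact (Category.comp_id _).trans (Category.id_comp _).symm)
    (fun r => by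
      rw [AffineGroupoid.fstTwo, Tens.lift_inr, RingHom.comp_apply, ActFunctor.actObj_inr,
        ActFunctor.actObj_inl]
      exact (Category.comp_id _).trans (Category.id_comp _).symm) z
  exact (Category.id_comp _).symm.trans (h.symm.trans (Category.comp_id _))

/-- The unit constraint over `S' → S`: the isomorphism `(1 × id)^* (act^* × id)(M) ≅ M`. -/
def unitBC (M : BC C ψ) :
    (pull (G.oneTimes ψ) (G.oneTimes_base ψ)).obj ((F.actBC ψ).obj M) ⟶ M :=
  pullDesc _ _ (F.unitHom M.X) (F.comm_of_tens M M _ _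
    (fun b => by
      rw [unitHom_comm, AffineGroupoid.oneTimes, Tens.lift_inl, RingHom.comp_apply, act_base])
    (fun r => by
      rw [unitHom_naturality, AffineGroupoid.oneTimes, Tens.lift_inr]; rfl))

/-- The associativity constraint over `S' → S`: the isomorphism
`(mult × id)^* (act^* × id_{S'})(M) ≅ (act^* × id_{G × S'})((act^* × id_{S'})(M))`. -/
def assocBC (M : BC C ψ) :
    (pull (G.multTimes ψ) (G.multTimes_base ψ)).obj ((F.actBC ψ).obj M) ⟶
      (F.actBC ((Tens.inl G.p₂ ψ).comp G.p₁)).obj ((F.actBC ψ).obj M) :=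
  pullDesc _ _ (F.assocHom M.X) (F.comm_of_tens M (F.actObj _ (F.actObj ψ M)) _ _
    (fun b => by
      rw [AffineGroupoid.multTimes, Tens.lift_inl, RingHom.comp_apply, actObj_fstTwo,
        assocHom_comm])
    (fun r => by
      rw [AffineGroupoid.multTimes, Tens.lift_inr, RingHom.comp_apply, ActFunctor.actObj_inr,
        ActFunctor.actObj_inr, assocHom_naturality]))

end PreAction

/-- An action of the groupoid `G` on the category `C` over `S`: a functor `act^*` with unit and
associativity constraints subject to the natural compatibility conditions. -/
structure CategoryAction extends PreAction G C where
  /-- The two isomorphisms from `act^*(X)_{g h k}` to `g (h (k X))` coincide. -/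
  assoc_compat : ∀ X : C,
    pullComp G.mult G.mult_p₁ (G.idTimes G.mult G.mult_p₁) (G.idTimes_base _ _)
        ((G.multTimes G.p₁).comp G.mult) G.triple_base G.assoc_eq (act.obj X) ≫
      (pull (G.idTimes G.mult G.mult_p₁) (G.idTimes_base _ _)).map (assoc.hom.app X) ≫
      toActFunctor.baseChange G.mult G.mult_p₁ (act.obj X) ≫
      (toActFunctor.actBC _).map (assoc.hom.app X) =
    pullComp G.mult G.mult_p₁ (G.multTimes G.p₁) (G.multTimes_base G.p₁)
        ((G.multTimes G.p₁).comp G.mult) G.triple_base rfl (act.obj X) ≫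
      (pull (G.multTimes G.p₁) (G.multTimes_base G.p₁)).map (assoc.hom.app X) ≫
      toPreAction.assocBC (act.obj X)
  /-- The composition `act^*(X)_{1 g} ≅ 1 (g X) ≅ g X` is the identity. -/
  one_compat : ∀ X : C,
    pullComp G.mult G.mult_p₁ (G.oneTimes G.p₁) (G.oneTimes_base G.p₁)
        (RingHom.id B) (RingHom.id_comp _) G.one_mult (act.obj X) ≫
      (pull (G.oneTimes G.p₁) (G.oneTimes_base G.p₁)).map (assoc.hom.app X) ≫
      toPreAction.unitBC (act.obj X) = pullId (act.obj X)
  /-- The composition `act^*(X)_{g 1} ≅ g (1 X) ≅ g X` is the identity. -/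
  compat_one : ∀ X : C,
    pullComp G.mult G.mult_p₁ G.timesOne G.timesOne_base
        (RingHom.id B) (RingHom.id_comp _) G.mult_one (act.obj X) ≫
      (pull G.timesOne G.timesOne_base).map (assoc.hom.app X) ≫
      toActFunctor.baseChangeOne (act.obj X) ≫
      act.map (unit.hom.app X).f = pullId (act.obj X)

variable {G C} (F : CategoryAction G C)

/-- A `G`-equivariant structure on `X`: an isomorphism `p₁^*(X) ≅ act^*(X)` compatible with the
unit and associativity constraints. -/
@[ext] structure EquivariantStructure (X : C) where
  α : (pullC G.p₁).obj X ≅ F.act.obj X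
  /-- The composition `X ≅ 1^* p₁^*(X) ≅ 1^* act^*(X) ≅ X` is the identity. -/
  unit_compat :
    pullComp G.p₁ (RingHom.comp_id _) G.one G.one_p₁ (RingHom.id A) (RingHom.id_comp _) G.one_p₁
        ((ofC A).obj X) ≫
      (pull G.one G.one_p₁).map α.hom ≫ F.unit.hom.app X = pullId ((ofC A).obj X)
  /-- The two isomorphisms from `X_{p₁(g)}` to `g (h X)` coincide: the first is `mult^*(α)` followed
  by the associativity constraint, the second is `pr₁^*(α)` followed by `(act^* × id_G)(α)`. -/
  assoc_compat :
    pullComp G.p₁ (RingHom.comp_id _) G.mult G.mult_p₁ ((Tens.inl G.p₂ G.p₁).comp G.p₁)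
        (RingHom.comp_id _) G.mult_p₁ ((ofC A).obj X) ≫
      (pull G.mult G.mult_p₁).map α.hom ≫ F.assoc.hom.app X =
    pullComp G.p₁ (RingHom.comp_id _) (Tens.inl G.p₂ G.p₁) rfl ((Tens.inl G.p₂ G.p₁).comp G.p₁)
        (RingHom.comp_id _) rfl ((ofC A).obj X) ≫
      (pull (Tens.inl G.p₂ G.p₁) rfl).map α.hom ≫ F.baseChangeBase G.p₁ X ≫
      (F.actBC G.p₁).map α.hom

/-- A morphism of `C` compatible with given equivariant structures. -/
def IsEquivariantHom {X Y : C} (E : EquivariantStructure F X) (E' : EquivariantStructure F Y)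
    (f : X ⟶ Y) : Prop :=
  E.α.hom ≫ F.act.map f = (pullC G.p₁).map f ≫ E'.α.hom

/-- `G`-equivariant objects of `C`. -/
structure EquivariantObject where
  obj : C
  str : EquivariantStructure F obj

/-- Morphisms of equivariant objects. -/
@[ext] structure EquivariantObject.Hom (X Y : EquivariantObject F) where
  f : X.obj ⟶ Y.obj
  equivariant : IsEquivariantHom F X.str Y.str f

instance : Category (EquivariantObject F) where
  Hom := EquivariantObject.Hom F
  id X := ⟨𝟙 X.obj, by
    rw [IsEquivariantHom, CategoryTheory.Functor.map_id, CategoryTheory.Functor.map_id, Category.comp_id, Category.id_comp]⟩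
  comp a b := ⟨a.f ≫ b.f, by
    rw [IsEquivariantHom, Functor.map_comp, Functor.map_comp, Category.assoc, ← b.equivariant,
      ← Category.assoc, a.equivariant, Category.assoc]⟩

/-- The forgetful functor from equivariant objects to `C`. -/
@[simps] def forgetEquivariant : EquivariantObject F ⥤ C where
  obj X := X.obj
  map a := a.f

/-- The functor `X ↦ (p₁)_*(act^*(X))`. -/
def coind : C ⥤ C := F.act ⋙ push G.p₁

/-- The functor to equivariant objects given by equivariant structures on the objects
`(p₁)_*(act^*(X))` for which the morphisms `(p₁)_*(act^*(f))` are equivariant. -/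
def coindEquivariant (E : ∀ X : C, EquivariantStructure F ((coind F).obj X))
    (hE : ∀ {X Y : C} (f : X ⟶ Y), IsEquivariantHom F (E X) (E Y) ((coind F).map f)) :
    C ⥤ EquivariantObject F where
  obj X := ⟨(coind F).obj X, E X⟩
  map f := ⟨(coind F).map f, hE f⟩
  map_id X := EquivariantObject.Hom.ext ((coind F).map_id X)
  map_comp f g := EquivariantObject.Hom.ext ((coind F).map_comp f g)

/-- The canonical morphism `p₁^*((p₁)_*(act^*(X))) → act^*((p₁)_*(act^*(X)))`, which corresponds by
adjunction to the associativity constraint `mult^* act^*(X) ≅ (act^* × id_G)(act^*(X))`. -/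
def coindHom (X : C) : (pullC G.p₁).obj ((coind F).obj X) ⟶ F.act.obj ((coind F).obj X) :=
  pullCDesc G.p₁ (F.assocHom X)

end Action

end GroupoidAction

end

open CategoryTheory CategoryTheory.Limits GroupoidAction

/-! The theorem is the cofree coalgebra adjunction for a comonad. Let `T` be `coind F`, the functor
$(p_1)_*\mathrm{act}^*$. By adjunction the unit constraint becomes a counit $\varepsilon : T \to
\mathrm{id}$ (`unitHom`) and the associativity constraint a comultiplication $\delta : T \to T^2$
(`assocHom`). The compatibilities required of an action then become the comonad laws
(`assocHom_unitHom`, `assocHom_map_unitHom`, `assocHom_coassoc`).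

In the same way an equivariant structure $\alpha$ on $X$ becomes a coaction $c : X \to TX$, its two
axioms become the counit and coassociativity laws, and equivariant morphisms become morphisms of
coalgebras (`isEquivariantHom_iff`). Conversely, a coaction gives an equivariant structure as soon
as its adjoint $p_1^*X \to \mathrm{act}^*X$ is invertible (`EquivariantStructure.ofCoaction`).

The one point that is not formal is this invertibility for the coaction $\delta_X$ on $TX$. With $M
= \mathrm{act}^*X$, the adjoint factors as $p_1^*(p_1)_*M \to \mathrm{mult}^*M \to
\mathrm{act}^*\mathrm{act}^*X$ (`coindHom_f`). The second map is the associativity constraint. The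
first is invertible because inverses in the groupoid make $(g,h) \mapsto (g,gh)$ an isomorphism
$\mathcal G\times_{p_2,p_1}\mathcal G \to \mathcal G\times_{p_1,p_1}\mathcal G$
(`isIso_multComparison`). -/

namespace GroupoidAction

/-! ### Computing with morphisms out of a pullback through the universal map $x \mapsto 1 \otimes
x$. -/

namespace BC

/-- A morphism of the base change is invertible as soon as the underlying morphism is. -/
theorem isIso_of_isIso_f {A R : Type u} [CommRing A] [CommRing R] {C : Type w} [Category.{v} C]
    [Preadditive C] [Linear A C] {ψ : A →+* R} {M N : BC C ψ} (a : M ⟶ N) [IsIso a.f] : IsIso a :=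
  ⟨⟨⟨inv a.f, fun r => by
      rw [IsIso.eq_inv_comp, ← Category.assoc, ← a.comm, Category.assoc, IsIso.hom_inv_id,
        Category.comp_id]⟩,
    hom_ext (IsIso.hom_inv_id a.f), hom_ext (IsIso.inv_hom_id a.f)⟩⟩

variable {A R R' R'' : Type u} [CommRing A] [CommRing R] [CommRing R'] [CommRing R'']
variable {C : Type w} [Category.{v} C] [Abelian C] [Linear A C] [HasFilteredColimitsOfSize.{u, u} C]
variable {ψ : A →+* R} {ψ' : A →+* R'} {ψ'' : A →+* R''}

theorem pullUnit_pullDesc_assoc (f : R →+* R') (hf : f.comp ψ = ψ') {M : BC C ψ} {N : BC C ψ'}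
    (g : M.X ⟶ N.X) (hg) {Z : C} (k : N.X ⟶ Z) :
    pullUnit f hf M ≫ (pullDesc f hf (N := N) g hg).f ≫ k = g ≫ k := by
  rw [← Category.assoc, pullUnit_pullDesc]

theorem pullUnit_map_assoc (f : R →+* R') (hf : f.comp ψ = ψ') {M N : BC C ψ} (a : M ⟶ N)
    {Z : C} (k : ((pull f hf).obj N).X ⟶ Z) :
    pullUnit f hf M ≫ ((pull f hf).map a).f ≫ k = a.f ≫ pullUnit f hf N ≫ k := by
  rw [← Category.assoc, pullUnit_map, Category.assoc]

theorem pullUnit_pullComp_assoc (f : R →+* R') (hf : f.comp ψ = ψ') (g : R' →+* R'')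
    (hg : g.comp ψ' = ψ'') (h : R →+* R'') (hh : h.comp ψ = ψ'') (e : g.comp f = h) (M : BC C ψ)
    {Z : C} (k : ((pull g hg).obj ((pull f hf).obj M)).X ⟶ Z) :
    pullUnit h hh M ≫ (pullComp f hf g hg h hh e M).f ≫ k =
      pullUnit f hf M ≫ pullUnit g hg ((pull f hf).obj M) ≫ k := by
  rw [pullComp, pullUnit_pullDesc_assoc, Category.assoc]

theorem pullUnit_pullId (M : BC C ψ) :
    pullUnit (RingHom.id R) (RingHom.id_comp ψ) M ≫ (pullId M).f = 𝟙 M.X :=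
  pullUnit_pullDesc _ _ _ _

theorem pullCUnit_pullCDesc (ψ : A →+* R) {X : C} {N : BC C ψ} (g : X ⟶ N.X) :
    pullCUnit ψ X ≫ (pullCDesc ψ (N := N) g).f = g :=
  pullUnit_pullDesc _ _ _ _

theorem pullCUnit_map (ψ : A →+* R) {X Y : C} (f : X ⟶ Y) :
    pullCUnit ψ X ≫ ((pullC ψ).map f).f = f ≫ pullCUnit ψ Y :=
  pullUnit_map ψ (RingHom.comp_id ψ) ((ofC A).map f)

theorem pullC_hom_ext {X : C} {N : BC C ψ} {p q : (pullC ψ).obj X ⟶ N}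
    (h : pullCUnit ψ X ≫ p.f = pullCUnit ψ X ≫ q.f) : p = q :=
  pull_hom_ext h

end BC

open BC

variable {A B : Type u} [CommRing A] [CommRing B]

/-! ### The comonad laws for $(p_1)_*\mathrm{act}^*$. -/

section Comonad

variable {G : AffineGroupoid A B}
  {C : Type w} [Category.{v} C] [Abelian C] [HasFilteredColimitsOfSize.{u, u} C]
  [Linear A C] (F : CategoryAction G C)

/-- Counit law $\varepsilon_{TX}\circ\delta_X = \mathrm{id}$: it is the adjoint form of the
constraint along $g \mapsto (1,g)$, where the unit constraint is applied to the outer copy of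
$\mathrm{act}^*$. -/
theorem assocHom_unitHom (X : C) : F.assocHom X ≫ F.unitHom (F.act.obj X).X = 𝟙 _ := by
  -- Restricted to the universal map, each pullback in the constraint collapses: `pullComp` becomes
  -- two successive universal maps, the second of which slides past the pulled back constraint. The
  -- proofs below follow the same pattern.
  have h := congrArg (fun k => pullUnit _ _ _ ≫ Hom.f k) (F.one_compat X)
  refine Eq.trans ?_ (h.trans (pullUnit_pullId (F.act.obj X)))
  refine Eq.symm ((pullUnit_pullComp_assoc _ _ _ _ _ _ _ _ _).trans ?_)
  refine Eq.trans (congrArg (pullUnit _ _ _ ≫ ·) (pullUnit_map_assoc _ _ _ _)) ?_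
  refine Eq.trans (congrArg (fun k => pullUnit _ _ _ ≫ (F.assoc.hom.app X).f ≫ k)
    (pullUnit_pullDesc _ _ _ _)) ?_
  exact (Category.assoc _ _ _).symm

/-- Counit law $T(\varepsilon_X)\circ\delta_X = \mathrm{id}$, from the constraint along $g \mapsto
(g,1)$: here the unit constraint sits inside $\mathrm{act}^*$, whence the final use of
functoriality. -/
theorem assocHom_map_unitHom (X : C) :
    F.assocHom X ≫ (F.act.map (F.unitHom X)).f = 𝟙 _ := by
  have h := congrArg (fun k => pullUnit _ _ _ ≫ Hom.f k) (F.compat_one X)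
  refine Eq.trans ?_ (h.trans (pullUnit_pullId (F.act.obj X)))
  refine Eq.symm ((pullUnit_pullComp_assoc _ _ _ _ _ _ _ _ _).trans ?_)
  refine Eq.trans (congrArg (pullUnit _ _ _ ≫ ·) (pullUnit_map_assoc _ _ _ _)) ?_
  refine Eq.trans (congrArg (fun k => pullUnit _ _ _ ≫ (F.assoc.hom.app X).f ≫ k)
    (pullUnit_pullDesc_assoc _ _ _ _ _)) ?_
  refine Eq.trans ?_ (Category.assoc _ _ _).symm
  exact congrArg (fun k => pullUnit _ _ _ ≫ (F.assoc.hom.app X).f ≫ k)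
    (F.map_comp_f _ _).symm

/-- The adjoint form of the constraint over triples of arrows. Bracketing as $g(hk)$ gives
$T(\delta_X)\circ\delta_X$, and bracketing as $(gh)k$ gives $\delta_{TX}\circ\delta_X$. -/
theorem assocHom_coassoc (X : C) :
    F.assocHom X ≫ F.assocHom (F.act.obj X).X =
      F.assocHom X ≫ (F.act.map (F.assocHom X)).f := by
  have h := congrArg (fun k => pullUnit _ _ _ ≫ Hom.f k) (F.assoc_compat X)
  have h₁ := (pullUnit_pullComp_assoc _ _ _ _ _ _ _ _ _).symm.trans
    (h.trans (pullUnit_pullComp_assoc _ _ _ _ _ _ _ _ _))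
  have h₂ := (congrArg (pullUnit _ _ _ ≫ ·) (pullUnit_map_assoc _ _ _ _)).symm.trans
    (h₁.trans (congrArg (pullUnit _ _ _ ≫ ·) (pullUnit_map_assoc _ _ _ _)))
  have h₃ := (congrArg (fun k => pullUnit _ _ _ ≫ (F.assoc.hom.app X).f ≫ k)
    (pullUnit_pullDesc_assoc _ _ _ _ _)).symm.trans
    (h₂.trans (congrArg (fun k => pullUnit _ _ _ ≫ (F.assoc.hom.app X).f ≫ k)
    (pullUnit_pullDesc _ _ _ _)))
  refine (Category.assoc _ _ _).trans (h₃.symm.trans ?_)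
  refine Eq.trans ?_ (Category.assoc _ _ _).symm
  exact congrArg (fun k => pullUnit _ _ _ ≫ (F.assoc.hom.app X).f ≫ k)
    (F.map_comp_f _ _).symm

end Comonad

/-! ### Equivariant structures as coactions of the comonad. -/

section Coaction

variable {G : AffineGroupoid A B}
  {C : Type w} [Category.{v} C] [Abelian C] [HasFilteredColimitsOfSize.{u, u} C]
  [Linear A C] {F : CategoryAction G C}

/-- An isomorphism `p₁^*(X) ≅ act^*(X)` whose adjoint `X → act^*(X)` is a coaction of the comonad
`(p₁)_* act^*` is an equivariant structure. -/
noncomputable def EquivariantStructure.ofCoaction {X : C} (α : (pullC G.p₁).obj X ≅ F.act.obj X)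
    (c : X ⟶ (F.act.obj X).X) (hc : pullCUnit G.p₁ X ≫ α.hom.f = c)
    (counit : c ≫ F.unitHom X = 𝟙 X)
    (coassoc : c ≫ F.assocHom X = c ≫ (F.act.map c).f) : EquivariantStructure F X where
  α := α
  unit_compat := pull_hom_ext (by
    refine Eq.trans ?_ (pullUnit_pullId _).symm
    refine (pullUnit_pullComp_assoc _ _ _ _ _ _ _ _ _).trans ?_
    refine Eq.trans (congrArg (pullUnit _ _ _ ≫ ·) (pullUnit_map_assoc _ _ _ _)) ?_
    refine (Category.assoc _ _ _).symm.trans ?_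
    exact (congrArg (· ≫ F.unitHom X) hc).trans counit)
  assoc_compat := pull_hom_ext (by
    refine (pullUnit_pullComp_assoc _ _ _ _ _ _ _ _ _).trans ?_
    refine Eq.trans (congrArg (pullUnit _ _ _ ≫ ·) (pullUnit_map_assoc _ _ _ _)) ?_
    refine Eq.trans ?_ (pullUnit_pullComp_assoc _ _ _ _ _ _ _ _ _).symm
    refine Eq.trans ?_ (congrArg (pullUnit _ _ _ ≫ ·) (pullUnit_map_assoc _ _ _ _)).symm
    refine (Category.assoc _ _ _).symm.trans ?_
    refine Eq.trans ?_ (Category.assoc _ _ _)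
    refine ((congrArg (· ≫ F.assocHom X) hc).trans coassoc).trans ?_
    refine Eq.trans ?_ (congrArg (fun k => (pullUnit _ _ _ ≫ α.hom.f) ≫ k)
      (pullUnit_pullDesc_assoc _ _ _ _ _)).symm
    -- With $c$ expanded, the base change map followed by $\mathrm{act}^*(\alpha)$ is
    -- $\mathrm{act}^*(c)$ by functoriality.
    subst hc
    exact congrArg (fun k => (pullCUnit G.p₁ X ≫ α.hom.f) ≫ k) (F.map_comp_f _ _))

namespace EquivariantStructure

variable {X Y : C} (E : EquivariantStructure F X) (E' : EquivariantStructure F Y)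

/-- The coaction `X → act^*(X)` adjoint to an equivariant structure. -/
noncomputable def coaction : X ⟶ (F.act.obj X).X := pullCUnit G.p₁ X ≫ E.α.hom.f

theorem coaction_unitHom : E.coaction ≫ F.unitHom X = 𝟙 X := by
  have h := congrArg (fun k => pullUnit _ _ _ ≫ Hom.f k) E.unit_compat
  have h₁ := (pullUnit_pullComp_assoc _ _ _ _ _ _ _ _ _).symm.trans (h.trans (pullUnit_pullId _))
  refine Eq.trans ?_ ((congrArg (pullUnit _ _ _ ≫ ·) (pullUnit_map_assoc _ _ _ _)).symm.trans h₁)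
  exact Category.assoc _ _ _

theorem coaction_coassoc :
    E.coaction ≫ F.assocHom X = E.coaction ≫ (F.act.map E.coaction).f := by
  have h := congrArg (fun k => pullUnit _ _ _ ≫ Hom.f k) E.assoc_compat
  have h₁ := (pullUnit_pullComp_assoc _ _ _ _ _ _ _ _ _).symm.trans
    (h.trans (pullUnit_pullComp_assoc _ _ _ _ _ _ _ _ _))
  have h₂ := (congrArg (pullUnit _ _ _ ≫ ·) (pullUnit_map_assoc _ _ _ _)).symm.trans
    (h₁.trans (congrArg (pullUnit _ _ _ ≫ ·) (pullUnit_map_assoc _ _ _ _)))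
  refine ((Category.assoc _ _ _).trans h₂).trans ?_
  refine (Category.assoc _ _ _).symm.trans ?_
  refine Eq.trans (congrArg (fun k => (pullUnit _ _ _ ≫ E.α.hom.f) ≫ k)
      (pullUnit_pullDesc_assoc _ _ _ _ _)) ?_
  exact congrArg (fun k => E.coaction ≫ k) (F.map_comp_f _ _).symm

/-- Both sides of the equivariance condition are morphisms out of $p_1^*X$, so they may be compared
on the universal map, where they become the two sides of the coalgebra condition. -/
theorem isEquivariantHom_iff (f : X ⟶ Y) : IsEquivariantHom F E E' f ↔
    E.coaction ≫ (F.act.map f).f = f ≫ E'.coaction := by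
  have h₁ : pullCUnit G.p₁ X ≫ (E.α.hom ≫ F.act.map f).f =
      E.coaction ≫ (F.act.map f).f := (Category.assoc _ _ _).symm
  have h₂ : pullCUnit G.p₁ X ≫ ((pullC G.p₁).map f ≫ E'.α.hom).f = f ≫ E'.coaction := by
    rw [comp_f, ← Category.assoc, pullCUnit_map, Category.assoc]; rfl
  rw [← h₁, ← h₂]
  exact ⟨fun h => congrArg (fun k => pullCUnit G.p₁ X ≫ Hom.f k) h, fun h => pullC_hom_ext h⟩

end EquivariantStructure

end Coaction

/-! ### Groupoid laws for points with values in a ring, and the shear isomorphism. -/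

theorem Tens.comp_lift {R D D' : Type u} [CommRing R] [CommRing D] [CommRing D'] {f : A →+* B}
    {g : A →+* R} (x : B →+* D) (y : R →+* D) (h : x.comp f = y.comp g) (k : D →+* D') :
    k.comp (Tens.lift x y h) = Tens.lift (k.comp x) (k.comp y)
      (by rw [RingHom.comp_assoc, h, RingHom.comp_assoc]) :=
  Tens.hom_ext (by ext; simp) (by ext; simp)

namespace AffineGroupoid

variable (G : AffineGroupoid A B) {D D' : Type u} [CommRing D] [CommRing D']

/-- The product of two composable points of the groupoid with values in `D`. -/
noncomputable def pointMul (x y : B →+* D) (h : x.comp G.p₂ = y.comp G.p₁) : B →+* D :=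
  (Tens.lift x y h).comp G.mult

theorem comp_pointMul (k : D →+* D') (x y : B →+* D) (h : x.comp G.p₂ = y.comp G.p₁) :
    k.comp (G.pointMul x y h) = G.pointMul (k.comp x) (k.comp y)
      (by rw [RingHom.comp_assoc, h, RingHom.comp_assoc]) := by
  rw [pointMul, ← RingHom.comp_assoc, Tens.comp_lift]; rfl

theorem pointMul_p₁ (x y : B →+* D) (h : x.comp G.p₂ = y.comp G.p₁) :
    (G.pointMul x y h).comp G.p₁ = x.comp G.p₁ := by
  rw [pointMul, RingHom.comp_assoc, G.mult_p₁]; ext; simp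

theorem pointMul_p₂ (x y : B →+* D) (h : x.comp G.p₂ = y.comp G.p₁) :
    (G.pointMul x y h).comp G.p₂ = y.comp G.p₂ := by
  rw [pointMul, RingHom.comp_assoc, G.mult_p₂]; ext; simp

theorem pointMul_assoc (x y z : B →+* D) (h : x.comp G.p₂ = y.comp G.p₁)
    (h' : y.comp G.p₂ = z.comp G.p₁) :
    G.pointMul x (G.pointMul y z h') (h.trans (G.pointMul_p₁ y z h').symm) =
      G.pointMul (G.pointMul x y h) z ((G.pointMul_p₂ x y h).trans h') := by
  have hyz : (Tens.lift y z h').comp (Tens.inl G.p₂ G.p₁) = y := by ext; simp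
  have hyz' : (Tens.lift y z h').comp (Tens.inr G.p₂ G.p₁) = z := by ext; simp
  -- The point $(x,(y,z))$ of $\mathcal G\times_S(\mathcal G\times_S\mathcal G)$; associativity for
  -- $x, y, z$ is the universal identity pulled back along it.
  let t := Tens.lift (f := G.p₂) (g := (Tens.inl G.p₂ G.p₁).comp G.p₁) x (Tens.lift y z h')
    (by rw [← RingHom.comp_assoc, hyz, h])
  have hl : t.comp (Tens.inl _ _) = x := by ext; simp [t]
  have hr : t.comp (Tens.inr _ _) = Tens.lift y z h' := by
    apply RingHom.ext; intro b; simp [t]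
  have e := congrArg t.comp G.mult_assoc
  simp only [← RingHom.comp_assoc, Tens.comp_lift] at e
  simp only [hl, hr, hyz, hyz'] at e
  exact e

/-- The unit is given by an equation rather than substituted into the statement, so that the lemma
applies to products such as $gg^{-1}$. -/
theorem pointMul_one_left (x y : B →+* D) (h : x.comp G.p₂ = y.comp G.p₁)
    (hx : x = (y.comp G.p₁).comp G.one) : G.pointMul x y h = y := by
  subst hx
  have e := congrArg y.comp G.one_mult
  rw [← RingHom.comp_assoc, Tens.comp_lift] at e
  exact e

theorem pointMul_inv (x : B →+* D) (h : x.comp G.p₂ = (x.comp G.inv).comp G.p₁) :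
    G.pointMul x (x.comp G.inv) h = (x.comp G.p₁).comp G.one := by
  have e := congrArg x.comp G.mult_inv
  rw [← RingHom.comp_assoc, Tens.comp_lift] at e
  exact e

theorem pointMul_inv_left (x : B →+* D) (h : (x.comp G.inv).comp G.p₂ = x.comp G.p₁) :
    G.pointMul (x.comp G.inv) x h = (x.comp G.p₂).comp G.one := by
  have e := congrArg x.comp G.inv_mult
  rw [← RingHom.comp_assoc, Tens.comp_lift] at e
  exact e

theorem pointMul_inl_inr :
    G.pointMul (Tens.inl G.p₂ G.p₁) (Tens.inr G.p₂ G.p₁) (Tens.inl_comp _ _) = G.mult := by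
  have : Tens.lift (Tens.inl G.p₂ G.p₁) (Tens.inr G.p₂ G.p₁) (Tens.inl_comp _ _) =
      RingHom.id _ := Tens.hom_ext (by ext; simp) (by ext; simp)
  rw [pointMul, this, RingHom.id_comp]

/-- The comorphism of the map `G ×_S G → G ×_{p₁,S,p₁} G`, `(g, h) ↦ (g, g h)`. -/
noncomputable def shear : Tens G.p₁ G.p₁ →+* Tens G.p₂ G.p₁ :=
  Tens.lift (Tens.inl _ _) G.mult G.mult_p₁.symm

/-- Composability of $g^{-1}$ and $k$ over $\mathcal G\times_{p_1,S,p_1}\mathcal G$: $p_2(g^{-1}) =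
p_1(g) = p_1(k)$. -/
theorem inl_comp_inv_comp_p₂ : ((Tens.inl G.p₁ G.p₁).comp G.inv).comp G.p₂ =
    (Tens.inr G.p₁ G.p₁).comp G.p₁ := by
  rw [RingHom.comp_assoc, G.inv_p₂, Tens.inl_comp]

/-- The comorphism of the map `G ×_{p₁,S,p₁} G → G ×_S G`, `(g, k) ↦ (g, g⁻¹ k)`. -/
noncomputable def unshear : Tens G.p₂ G.p₁ →+* Tens G.p₁ G.p₁ :=
  Tens.lift (Tens.inl _ _)
    (G.pointMul ((Tens.inl _ _).comp G.inv) (Tens.inr _ _) G.inl_comp_inv_comp_p₂)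
    (by rw [pointMul_p₁, RingHom.comp_assoc, G.inv_p₁])

theorem unshear_inl (b : B) : G.unshear (Tens.inl _ _ b) = Tens.inl _ _ b := Tens.lift_inl ..

/-- This is $g(g^{-1}k) = k$. Together with `unshear_inl` it says that `unshear` after `shear` is
the identity on both tensor factors. -/
theorem unshear_comp_mult : G.unshear.comp G.mult = Tens.inr _ _ := by
  have hi : ((Tens.inl G.p₁ G.p₁)).comp G.p₂ = ((Tens.inl G.p₁ G.p₁).comp G.inv).comp G.p₁ := by
    rw [RingHom.comp_assoc, G.inv_p₁]
  refine (G.pointMul_assoc _ _ _ hi G.inl_comp_inv_comp_p₂).trans ?_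
  exact G.pointMul_one_left _ _ _ (by rw [pointMul_inv, Tens.inl_comp])

/-- On the second factor this is $g^{-1}(gh) = h$. -/
theorem shear_comp_unshear : G.shear.comp G.unshear = RingHom.id _ := by
  have hl : G.shear.comp (Tens.inl _ _) = Tens.inl _ _ := by ext; simp [shear]
  have hr : G.shear.comp (Tens.inr _ _) = G.mult := by ext; simp [shear]
  refine Tens.hom_ext ?_ ?_
  · ext b
    simp [unshear_inl, shear]
  · have hu : G.unshear.comp (Tens.inr _ _) = G.pointMul ((Tens.inl _ _).comp G.inv)
        (Tens.inr _ _) G.inl_comp_inv_comp_p₂ := by ext; simp [unshear]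
    have hi : ((Tens.inl G.p₂ G.p₁).comp G.inv).comp G.p₂ = (Tens.inl G.p₂ G.p₁).comp G.p₁ := by
      rw [RingHom.comp_assoc, G.inv_p₂]
    rw [RingHom.comp_assoc, hu, comp_pointMul]
    simp only [← RingHom.comp_assoc, hl, hr]
    have e := G.pointMul_assoc _ _ _ hi (Tens.inl_comp G.p₂ G.p₁)
    simp only [pointMul_inl_inr] at e
    rw [e, RingHom.id_comp]
    exact G.pointMul_one_left _ _ _ (by rw [pointMul_inv_left, Tens.inl_comp])

end AffineGroupoid

/-! ### The two commuting actions of $B$ on $B \otimes_A M$. -/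

section PullCTens

variable {C : Type w} [Category.{v} C] [Abelian C] [HasFilteredColimitsOfSize.{u, u} C]
  [Linear A C] {ψ : A →+* B}

/-- The action of `B` on `B ⊗_A M` by functoriality, for an object `M` with an action of `B`. -/
noncomputable def pullCTransport (M : BC C ψ) : B →+* End ((pullC ψ).obj M.X).X where
  toFun := fun b => ((pullC ψ).map (M.act b)).f
  map_one' := by rw [act_one, (pullC ψ).map_id]; rfl
  map_mul' := fun b b' => by rw [mul_comm, act_mul, (pullC ψ).map_comp]; rfl
  map_zero' := by
    -- The zero map is packaged as a $B$-linear morphism so that the comparison can be made on the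
    -- universal map; sums and scalars are handled likewise below.
    refine congrArg Hom.f (pullC_hom_ext (q := ⟨0, by simp⟩) ?_)
    rw [pullCUnit_map, show M.act 0 = 0 from map_zero M.ρ]
    simp
  map_add' := fun b b' => by
    refine congrArg Hom.f (pullC_hom_ext (q := ⟨((pullC ψ).map (M.act b)).f +
      ((pullC ψ).map (M.act b')).f, fun r => by
        rw [Preadditive.comp_add, Preadditive.add_comp, Hom.comm, Hom.comm]⟩) ?_)
    simp [Preadditive.comp_add, pullCUnit_map, act_add]

/-- Both actions of $B$ restrict to scalar multiplication by $A$, which is what lets them combine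
into an action of $B \otimes_A B$. -/
theorem pullCTransport_base (M : BC C ψ) (a : A) :
    ((pullC ψ).obj M.X).ρ (ψ a) = pullCTransport M (ψ a) := by
  refine (((pullC ψ).obj M.X).compat a).trans ?_
  refine congrArg Hom.f (pullC_hom_ext (p := ⟨a • 𝟙 _, fun r => by simp⟩)
    (q := (pullC ψ).map (M.act (ψ a))) ?_)
  rw [pullCUnit_map, act_base]
  simp

theorem pullCTransport_comm (M : BC C ψ) (b b' : B) :
    ((pullC ψ).obj M.X).ρ b * pullCTransport M b' =
      pullCTransport M b' * ((pullC ψ).obj M.X).ρ b :=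
  (((pullC ψ).map (M.act b')).comm b).symm

/-- The action of `B ⊗_A B` on `B ⊗_A M` for an object `M` with an action of `B`. -/
noncomputable abbrev pullCTens (M : BC C ψ) : BC C ((Tens.inl ψ ψ).comp ψ) where
  X := ((pullC ψ).obj M.X).X
  ρ := Tens.liftNC ((pullC ψ).obj M.X).ρ (pullCTransport M)
    (pullCTransport_base M) (pullCTransport_comm M)
  compat a := (Tens.liftNC_inl _ _ _ _ _).trans (((pullC ψ).obj M.X).compat a)

theorem pullCTens_inl (M : BC C ψ) (b : B) :
    (pullCTens M).act (Tens.inl ψ ψ b) = ((pullC ψ).obj M.X).act b :=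
  Tens.liftNC_inl ((pullC ψ).obj M.X).ρ (pullCTransport M)
    (pullCTransport_base M) (pullCTransport_comm M) b

theorem pullCTens_inr (M : BC C ψ) (b : B) :
    (pullCTens M).act (Tens.inr ψ ψ b) = ((pullC ψ).map (M.act b)).f :=
  Tens.liftNC_inr ((pullC ψ).obj M.X).ρ (pullCTransport M)
    (pullCTransport_base M) (pullCTransport_comm M) b

end PullCTens

/-! ### Invertibility of the comparison $p_1^*(p_1)_*M \to \mathrm{mult}^*M$. -/

section Iso

variable {G : AffineGroupoid A B}
  {C : Type w} [Category.{v} C] [Abelian C] [HasFilteredColimitsOfSize.{u, u} C]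
  [Linear A C]

/-- The canonical morphism `p₁^*(M) → mult^*(M)`, `b ⊗ x ↦ (b ⊗ 1) ⊗ x`. -/
noncomputable def multComparison (M : BC C G.p₁) :
    ((pullC G.p₁).obj M.X).X ⟶ ((pull G.mult G.mult_p₁).obj M).X :=
  (pullCDesc G.p₁ (N := (restr (Tens.inl G.p₂ G.p₁) rfl).obj ((pull G.mult G.mult_p₁).obj M))
    (pullUnit G.mult G.mult_p₁ M)).f

theorem pullCUnit_multComparison (M : BC C G.p₁) :
    pullCUnit G.p₁ M.X ≫ multComparison M = pullUnit G.mult G.mult_p₁ M :=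
  pullCUnit_pullCDesc G.p₁
    (N := (restr (Tens.inl G.p₂ G.p₁) rfl).obj ((pull G.mult G.mult_p₁).obj M)) _

theorem multComparison_comm_inl (M : BC C G.p₁) (b : B) :
    ((pullC G.p₁).obj M.X).act b ≫ multComparison M =
      multComparison M ≫ ((pull G.mult G.mult_p₁).obj M).act (Tens.inl _ _ b) :=
  (pullCDesc G.p₁ (N := (restr (Tens.inl G.p₂ G.p₁) rfl).obj ((pull G.mult G.mult_p₁).obj M))
    (pullUnit G.mult G.mult_p₁ M)).comm b

/-- Both sides are linear over the first factor $B$, and on the universal map the claim is the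
relation $1 \otimes bx = \mathrm{mult}(b) \otimes x$ in $\mathrm{mult}^*M$. -/
theorem multComparison_comm_mult (M : BC C G.p₁) (b : B) :
    ((pullC G.p₁).map (M.act b)).f ≫ multComparison M =
      multComparison M ≫ ((pull G.mult G.mult_p₁).obj M).act (G.mult b) := by
  let N := (restr (Tens.inl G.p₂ G.p₁) rfl).obj ((pull G.mult G.mult_p₁).obj M)
  refine congrArg Hom.f (pullC_hom_ext (N := N)
    (p := ⟨((pullC G.p₁).map (M.act b)).f ≫ multComparison M, fun r => ?_⟩)
    (q := ⟨multComparison M ≫ ((pull G.mult G.mult_p₁).obj M).act (G.mult b), fun r => ?_⟩) ?_)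
  · change ((pullC G.p₁).obj M.X).act r ≫ ((pullC G.p₁).map (M.act b)).f ≫ multComparison M =
      (((pullC G.p₁).map (M.act b)).f ≫ multComparison M) ≫
        ((pull G.mult G.mult_p₁).obj M).act (Tens.inl _ _ r)
    rw [← Category.assoc, Hom.comm, Category.assoc, multComparison_comm_inl, Category.assoc]
  · change ((pullC G.p₁).obj M.X).act r ≫ multComparison M ≫
        ((pull G.mult G.mult_p₁).obj M).act (G.mult b) =
      (multComparison M ≫ ((pull G.mult G.mult_p₁).obj M).act (G.mult b)) ≫
        ((pull G.mult G.mult_p₁).obj M).act (Tens.inl _ _ r)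
    rw [← Category.assoc, multComparison_comm_inl, Category.assoc, ← act_mul, mul_comm, act_mul,
      Category.assoc]
  · change pullCUnit G.p₁ M.X ≫ ((pullC G.p₁).map (M.act b)).f ≫ multComparison M =
      pullCUnit G.p₁ M.X ≫ multComparison M ≫ ((pull G.mult G.mult_p₁).obj M).act (G.mult b)
    rw [← Category.assoc, pullCUnit_map, Category.assoc, pullCUnit_multComparison,
      ← Category.assoc, pullCUnit_multComparison, pullUnit_comm]

/-- Since `shear` is the inclusion on the first factor and `mult` on the second, this combines the
two preceding linearity statements. -/
theorem multComparison_comm (M : BC C G.p₁) (t : Tens G.p₁ G.p₁) :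
    (pullCTens M).act t ≫ multComparison M =
      multComparison M ≫ ((pull G.mult G.mult_p₁).obj M).act (G.shear t) := by
  induction t using Tens.induction with
  | add x y hx hy => rw [act_add, map_add, act_add, Preadditive.add_comp, Preadditive.comp_add,
      hx, hy]
  | mul b b' =>
    rw [act_mul, map_mul, act_mul, pullCTens_inl, pullCTens_inr, AffineGroupoid.shear,
      Tens.lift_inl, Tens.lift_inr, Category.assoc, multComparison_comm_mult, ← Category.assoc,
      multComparison_comm_inl, Category.assoc]

/-- The inverse of the canonical morphism `p₁^*(M) → mult^*(M)`: the functions on `G ×_S G` act on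
`p₁^*(M)` through `(g, k) ↦ (g, g⁻¹ k)`. -/
noncomputable def multComparisonInv (M : BC C G.p₁) : (pull G.mult G.mult_p₁).obj M ⟶
    (restr (ψ := (Tens.inl G.p₂ G.p₁).comp G.p₁) G.unshear
      (by ext a; simp [G.unshear_inl])).obj (pullCTens M) :=
  -- Linearity along `mult` holds because `unshear` carries `mult` to the second inclusion, through
  -- which $B$ acts by functoriality.
  pullDesc G.mult G.mult_p₁ (pullCUnit G.p₁ M.X) (fun b => by
    refine (pullCUnit_map G.p₁ (M.act b)).symm.trans ?_
    refine congrArg (pullCUnit G.p₁ M.X ≫ ·) ?_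
    refine (pullCTens_inr M b).symm.trans ?_
    exact congrArg (pullCTens M).act (RingHom.congr_fun G.unshear_comp_mult b).symm)

/-- The two maps exchange the universal maps, so each composite fixes a universal map and is the
identity once it is known to be linear. Linearity of one composite uses that `unshear` fixes the
first factor, that of the other that `shear` after `unshear` is the identity. -/
theorem isIso_multComparison (M : BC C G.p₁) : IsIso (multComparison M) := by
  let v : ((pull G.mult G.mult_p₁).obj M).X ⟶ ((pullC G.p₁).obj M.X).X := (multComparisonInv M).f
  have hv : pullUnit G.mult G.mult_p₁ M ≫ v = pullCUnit G.p₁ M.X :=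
    pullUnit_pullDesc _ _ _ _
  have hc : ∀ t, ((pull G.mult G.mult_p₁).obj M).act t ≫ v =
      v ≫ (pullCTens M).act (G.unshear t) := (multComparisonInv M).comm
  refine ⟨v, ?_, ?_⟩
  · refine congrArg Hom.f (pullC_hom_ext (N := (pullC G.p₁).obj M.X)
      (p := ⟨multComparison M ≫ v, fun b => ?_⟩) (q := 𝟙 _) ?_)
    · rw [← Category.assoc, multComparison_comm_inl, Category.assoc, hc, G.unshear_inl,
        pullCTens_inl, Category.assoc]
    · change pullCUnit G.p₁ M.X ≫ multComparison M ≫ v = pullCUnit G.p₁ M.X ≫ 𝟙 _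
      rw [← Category.assoc, pullCUnit_multComparison, hv, Category.comp_id]
  · refine congrArg Hom.f (pull_hom_ext (N := (pull G.mult G.mult_p₁).obj M)
      (p := ⟨v ≫ multComparison M, fun t => ?_⟩) (q := 𝟙 _) ?_)
    · have ht : G.shear (G.unshear t) = t := RingHom.congr_fun G.shear_comp_unshear t
      rw [← Category.assoc, hc, Category.assoc, multComparison_comm, ht, Category.assoc]
    · change pullUnit G.mult G.mult_p₁ M ≫ v ≫ multComparison M =
        pullUnit G.mult G.mult_p₁ M ≫ 𝟙 _
      rw [← Category.assoc, hv, pullCUnit_multComparison, Category.comp_id]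

/-! ### The canonical equivariant structure on $(p_1)_*\mathrm{act}^*(X)$. -/

variable (F : CategoryAction G C)

/-- The composite is $B$-linear because the associativity constraint is linear over $B \otimes_A B$,
whose first factor acts on $\mathrm{act}^*\mathrm{act}^*X$ by the given $B$-structure. On the
universal map both sides are `assocHom`. -/
theorem coindHom_f (X : C) :
    (coindHom F X).f = multComparison (F.act.obj X) ≫ (F.assoc.hom.app X).f := by
  let q : (pullC G.p₁).obj ((coind F).obj X) ⟶ F.act.obj ((coind F).obj X) :=
    ⟨multComparison (F.act.obj X) ≫ (F.assoc.hom.app X).f, fun b => by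
      refine (Category.assoc _ _ _).symm.trans ?_
      refine (congrArg (· ≫ (F.assoc.hom.app X).f)
        (multComparison_comm_inl (F.act.obj X) b)).trans ?_
      refine (Category.assoc _ _ _).trans (Eq.trans ?_ (Category.assoc _ _ _).symm)
      refine congrArg (multComparison (F.act.obj X) ≫ ·) ?_
      refine ((F.assoc.hom.app X).comm (Tens.inl _ _ b)).trans ?_
      exact congrArg ((F.assoc.hom.app X).f ≫ ·) (F.actObj_inl (F.act.obj X) b)⟩
  refine congrArg Hom.f (pullC_hom_ext (p := coindHom F X) (q := q) ?_)
  refine (pullCUnit_pullCDesc G.p₁ _).trans ?_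
  refine Eq.trans ?_ (Category.assoc _ _ _)
  exact (congrArg (· ≫ (F.assoc.hom.app X).f)
    (pullCUnit_multComparison (F.act.obj X))).symm

theorem isIso_coindHom (X : C) : IsIso (coindHom F X) := by
  have h₁ : IsIso (multComparison (F.act.obj X)) := isIso_multComparison _
  have h₂ : IsIso (F.assoc.hom.app X).f :=
    inferInstanceAs (IsIso ((push ((Tens.inl G.p₂ G.p₁).comp G.p₁)).map (F.assoc.hom.app X)))
  have h : IsIso (coindHom F X).f := by
    rw [coindHom_f]
    exact IsIso.comp_isIso' h₁ h₂
  exact isIso_of_isIso_f _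

/-- The canonical equivariant structure on `(p₁)_* act^*(X)`. -/
noncomputable def coindStructure (X : C) : EquivariantStructure F ((coind F).obj X) :=
  haveI := isIso_coindHom F X
  -- The cofree coalgebra on $X$: $\delta_X$ is a coaction on $TX$ by the comonad laws.
  .ofCoaction (asIso (coindHom F X)) (F.assocHom X) (pullCUnit_pullCDesc G.p₁ _)
    (assocHom_unitHom F X) (assocHom_coassoc F X)

theorem coindStructure_coaction (X : C) : (coindStructure F X).coaction = F.assocHom X :=
  pullCUnit_pullCDesc G.p₁ _

theorem isEquivariantHom_coind_map {X Y : C} (f : X ⟶ Y) :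
    IsEquivariantHom F (coindStructure F X) (coindStructure F Y) ((coind F).map f) := by
  rw [EquivariantStructure.isEquivariantHom_iff, coindStructure_coaction,
    coindStructure_coaction]
  exact (F.assocHom_naturality f).symm

/-! ### The cofree coalgebra adjunction. -/

/-- Equivariant morphisms to `(p₁)_* act^*(Y)` are the same as morphisms to `Y`. -/
noncomputable def coindHomEquiv (X : EquivariantObject F) (Y : C) :
    ((forgetEquivariant F).obj X ⟶ Y) ≃
      (X ⟶ (coindEquivariant F (coindStructure F) (isEquivariantHom_coind_map F)).obj Y) where
  -- A morphism $f$ goes to $T(f)\circ c$, which is a coalgebra map by coassociativity of $c$ and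
  -- naturality of $\delta$.
  toFun f := ⟨X.str.coaction ≫ (F.act.map f).f, by
    refine (EquivariantStructure.isEquivariantHom_iff _ (coindStructure F Y) _).2 ?_
    rw [coindStructure_coaction]
    refine (congrArg (X.str.coaction ≫ ·) (F.map_comp_f _ _)).trans ?_
    refine Eq.trans ?_ (Category.assoc _ _ _).symm
    refine Eq.trans ?_ (congrArg (X.str.coaction ≫ ·) (F.assocHom_naturality f)).symm
    refine (Category.assoc _ _ _).symm.trans (Eq.trans ?_ (Category.assoc _ _ _))
    exact congrArg (· ≫ _) X.str.coaction_coassoc.symm⟩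
  invFun g := g.f ≫ F.unitHom Y
  -- Naturality of $\varepsilon$ reduces this to the counit law of the coaction on $X$.
  left_inv f := by
    refine (Category.assoc _ _ _).trans ?_
    refine (congrArg (X.str.coaction ≫ ·) (F.unitHom_naturality f)).trans ?_
    refine (Category.assoc _ _ _).symm.trans ?_
    exact (congrArg (· ≫ f) X.str.coaction_unitHom).trans (Category.id_comp f)
  -- As $g$ is a coalgebra map, $T(\varepsilon_Y)\circ T(g)\circ c =
  -- T(\varepsilon_Y)\circ\delta_Y\circ g$, which is $g$ by the second counit law.
  right_inv g := by
    refine EquivariantObject.Hom.ext ?_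
    have h := (EquivariantStructure.isEquivariantHom_iff _ (coindStructure F Y) _).1 g.equivariant
    rw [coindStructure_coaction] at h
    refine (congrArg (X.str.coaction ≫ ·) (F.map_comp_f g.f (F.unitHom Y))).trans ?_
    refine (Category.assoc _ _ _).symm.trans ?_
    refine (congrArg (· ≫ (F.act.map (F.unitHom Y)).f) h).trans ?_
    refine (Category.assoc _ _ _).trans ?_
    exact (congrArg (g.f ≫ ·) (assocHom_map_unitHom F Y)).trans (Category.comp_id g.f)

/-- The functor `(p₁)_* act^*` is right adjoint to the forgetful functor. -/
noncomputable def forgetCoindAdjunction : forgetEquivariant F ⊣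
    coindEquivariant F (coindStructure F) (isEquivariantHom_coind_map F) :=
  Adjunction.mkOfHomEquiv
    { homEquiv := coindHomEquiv F
      homEquiv_naturality_left_symm := fun _ _ => Category.assoc _ _ _
      homEquiv_naturality_right := fun {X _ _} f g => by
        refine EquivariantObject.Hom.ext ?_
        refine (congrArg (X.str.coaction ≫ ·) (F.map_comp_f f g)).trans ?_
        exact (Category.assoc _ _ _).symm }

end Iso

end GroupoidAction

theorem lemma15 {A B : Type u} [CommRing A] [CommRing B] (G : AffineGroupoid A B)
    (h₁ : G.p₁.Flat) (h₂ : G.p₂.Flat)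
    {C : Type w} [Category.{v} C] [Abelian C] [HasFilteredColimitsOfSize.{u, u} C]
    [AB5OfSize.{u, u} C] [Linear A C] (F : CategoryAction G C) :
    ∃ (E : ∀ X : C, EquivariantStructure F ((coind F).obj X))
      (hE : ∀ {X Y : C} (f : X ⟶ Y), IsEquivariantHom F (E X) (E Y) ((coind F).map f)),
      (∀ X : C, (E X).α.hom = coindHom F X) ∧
      Nonempty (forgetEquivariant F ⊣ coindEquivariant F E hE) :=
  ⟨coindStructure F, isEquivariantHom_coind_map F, fun _ => rfl, ⟨forgetCoindAdjunction F⟩⟩
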